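/- Let $K$ be an algebraically closed field, and let $G$ be a finite undirected simple graph on $n$ vertices whose edges carry nonzero weights in $K$. Assume that the characteristic of $K$ is $0$ or greater than $n$. Let $A$ be the weighted adjacency matrix of $G$, that is, the symmetric $n\times n$ matrix with zero diagonal whose $(i,j)$ entry is the weight of the edge $ij$ if $i$ and $j$ are adjacent, and $0$ otherwise. Suppose that $G$ has at least one edge, and that it is not the case that $G$ is complete with all edge weights equal up to sign. Then there exists a nonzero diagonal matrix $D$ with entries in $K$ such that $A$ and $A+D$ have the same spectrum, i.e. the same multiset of eigenvalues counted with algebraic multiplicity. -/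

import Mathlib

/-- The adjacency matrix of the simple graph `G` whose edge `e` carries the weight `w e`.
The values of `w` on pairs that are not edges of `G` play no role. -/
def weightedAdjMatrix {V K : Type*} [Zero K] (G : SimpleGraph V) [DecidableRel G.Adj]
    (w : Sym2 V → K) : Matrix V V K :=
  Matrix.of fun i j => if G.Adj i j then w s(i, j) else 0

/-- The spectrum of a square matrix over a field, as a multiset: the eigenvalues in the field,
counted with algebraic multiplicity. -/
noncomputable def spectrumMultiset {V K : Type*} [Fintype V] [DecidableEq V] [Field K]
    (A : Matrix V V K) : Multiset K :=
  A.charpoly.roots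

/-! Suppose that `D = 0` is the only diagonal matrix for which `A - D` and `A` have the same
characteristic polynomial. It suffices to deduce that all off-diagonal entries of `A` have equal
squares (`sq_eq_sq_of_unique_fiber`): an edge then makes them all nonzero, so `G` is complete with
weights equal up to sign.

For zero-diagonal `A`, the coefficients of the characteristic polynomial of `A - D` are polynomials
in the entries of `D` with the elementary symmetric polynomials as leading forms. Hence over a
domain every fiber of `D ↦ charpoly (A - D)` has a coordinate ring free of rank `n!` on the Artin
monomials (`exists_normalForm`), and multiplication by a polynomial `g` has a trace compatible with
base change.

Take `g = x_i x_j - x_k x_l`, fix `Δ = diag μ` with distinct `μ p`, and let `T₂(t)` be the trace of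
`g` on the fiber through `tΔ`. At `t = 0` the fiber is the single point `0`, where `g` vanishes, so
`g` is nilpotent and `T₂(0) = 0`. Rescaling `D` gives `T₁(t) = t² T₂(1/t)`, where `T₁` belongs to
`tA` and the fiber through `Δ`; so the `t²` coefficient of `T₁` is zero. Modulo `t³` that fiber has
`n!` explicit points, given by second-order perturbation from the permutations of `μ`. Summing `g`
over them gives `t² n! (A_ij² - A_kl²)` (`trace_eq_of_isMulMatrix_of_cube_eq_zero`), and `n!` is
invertible. -/

open MvPolynomial

/-! ### Artin monomials and division by monic polynomials -/

/-- Exponent vectors of the Artin monomials: the `i`-th exponent is less than `n - i`. -/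
abbrev ArtinIndex (n : ℕ) : Type := (i : Fin n) → Fin (n - i)

/-- The Artin monomial with the given exponent vector. -/
noncomputable def artinMonomial {n : ℕ} (R : Type*) [CommRing R] (a : ArtinIndex n) :
    MvPolynomial (Fin n) R :=
  ∏ i, X i ^ (a i : ℕ)

theorem card_artinIndex (n : ℕ) : Fintype.card (ArtinIndex n) = n.factorial := by
  rw [Fintype.card_pi]
  simp only [Fintype.card_fin]
  rw [Fin.prod_univ_eq_prod_range (fun i => n - i) n, ← Finset.prod_range_reflect,
    ← Finset.prod_range_add_one_eq_factorial]
  refine Finset.prod_congr rfl fun i hi => ?_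
  have := Finset.mem_range.1 hi
  omega

/-- Division by a monic polynomial can be carried out over the subring, and the quotient is unique.
-/
theorem coeff_mem_of_X_sub_C_mul {S : Type*} [CommRing S] (A : Subring S) {x : S} (hx : x ∈ A)
    {q : Polynomial S}
    (h : ∀ k, ((Polynomial.X - Polynomial.C x) * q).coeff k ∈ A) (k : ℕ) : q.coeff k ∈ A := by
  have hl : (Polynomial.X - Polynomial.C x) * q ∈ Polynomial.lifts A.subtype := by
    rw [Polynomial.lifts_iff_coeff_lifts]
    intro k
    exact ⟨⟨_, h k⟩, rfl⟩
  obtain ⟨f, hf⟩ := (Polynomial.mem_lifts _).1 hl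
  have hq : q = (f /ₘ (Polynomial.X - Polynomial.C ⟨x, hx⟩)).map A.subtype := by
    rw [Polynomial.map_divByMonic _ (Polynomial.monic_X_sub_C _), hf]
    simp only [Polynomial.map_sub, Polynomial.map_X, Polynomial.map_C, Subring.subtype_apply]
    rw [Polynomial.mul_divByMonic_cancel_left _ (Polynomial.monic_X_sub_C _)]
  rw [hq, Polynomial.coeff_map]
  exact Subtype.property _

theorem exists_aeval_eq_of_mem_adjoin {k S : Type*} [CommRing k] [CommRing S] [Algebra k S]
    (A : Subalgebra k S) (x : S) {y : S} (hy : y ∈ Algebra.adjoin k ((A : Set S) ∪ {x})) :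
    ∃ p : Polynomial A, Polynomial.aeval x p = y := by
  induction hy using Algebra.adjoin_induction with
  | mem y hy =>
    rcases hy with hy | rfl
    · exact ⟨Polynomial.C ⟨y, hy⟩, by rw [Polynomial.aeval_C]; rfl⟩
    · exact ⟨Polynomial.X, Polynomial.aeval_X y⟩
  | algebraMap r =>
    exact ⟨Polynomial.C (algebraMap k A r), by rw [Polynomial.aeval_C]; rfl⟩
  | add a b _ _ ha hb =>
    obtain ⟨p, rfl⟩ := ha
    obtain ⟨q, rfl⟩ := hb
    exact ⟨p + q, map_add _ _ _⟩
  | mul a b _ _ ha hb =>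
    obtain ⟨p, rfl⟩ := ha
    obtain ⟨q, rfl⟩ := hb
    exact ⟨p * q, map_mul _ _ _⟩

theorem exists_eq_sum_of_mem_adjoin {k S : Type*} [CommRing k] [CommRing S] [Algebra k S]
    (A : Subalgebra k S) {f : Polynomial S} (hf : f.Monic) (hA : ∀ i, f.coeff i ∈ A)
    (hd : f.natDegree ≠ 0) {x : S} (hx : f.eval x = 0) {y : S}
    (hy : y ∈ Algebra.adjoin k ((A : Set S) ∪ {x})) :
    ∃ c : ℕ → A, y = ∑ l ∈ Finset.range f.natDegree, (c l : S) * x ^ l := by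
  obtain ⟨p, rfl⟩ := exists_aeval_eq_of_mem_adjoin A x hy
  have hlift : f ∈ Polynomial.lifts (algebraMap A S) := by
    rw [Polynomial.lifts_iff_coeff_lifts]
    exact fun i => ⟨⟨_, hA i⟩, rfl⟩
  obtain ⟨q, hq, hqd, hqm⟩ := Polynomial.lifts_and_natDegree_eq_and_monic hlift hf
  have hroot : Polynomial.aeval x q = 0 := by
    rw [Polynomial.aeval_def, ← Polynomial.eval_map, hq, hx]
  have hq1 : q ≠ 1 := by
    rintro rfl
    rw [Polynomial.natDegree_one] at hqd
    exact hd hqd.symm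
  refine ⟨(p %ₘ q).coeff, ?_⟩
  rw [← Polynomial.aeval_modByMonic_eq_self_of_root hroot,
    Polynomial.aeval_eq_sum_range' (Polynomial.natDegree_modByMonic_lt p hqm hq1), hqd]
  exact Finset.sum_congr rfl fun l _ => Algebra.smul_def _ _

/-! ### Artin monomials span over the symmetric polynomials -/

section Artin

variable {n : ℕ} (R : Type*) [CommRing R]

/-- The subalgebra generated over the symmetric polynomials by the first `j` variables. -/
noncomputable def headAlgebra (n j : ℕ) :
    Subalgebra (symmetricSubalgebra (Fin n) R) (MvPolynomial (Fin n) R) :=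
  Algebra.adjoin _ (X '' {i : Fin n | (i : ℕ) < j})

/-- The polynomial with roots the variables from index `j` on. -/
noncomputable def tailPolynomial (n j : ℕ) : Polynomial (MvPolynomial (Fin n) R) :=
  ∏ i ∈ Finset.univ.filter (fun i : Fin n => j ≤ (i : ℕ)), (Polynomial.X - Polynomial.C (X i))

theorem tailPolynomial_succ {j : ℕ} (hj : j < n) :
    tailPolynomial R n j =
      (Polynomial.X - Polynomial.C (X ⟨j, hj⟩)) * tailPolynomial R n (j + 1) := by
  have : Finset.univ.filter (fun i : Fin n => j ≤ (i : ℕ)) =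
      insert ⟨j, hj⟩ (Finset.univ.filter (fun i : Fin n => j + 1 ≤ (i : ℕ))) := by
    ext i
    simp only [Finset.mem_filter, Finset.mem_univ, true_and, Finset.mem_insert, Fin.ext_iff]
    omega
  rw [tailPolynomial, this, Finset.prod_insert (by simp), tailPolynomial]

theorem headAlgebra_mono {j j' : ℕ} (h : j ≤ j') : headAlgebra R n j ≤ headAlgebra R n j' :=
  Algebra.adjoin_mono (Set.image_mono fun _ hi => lt_of_lt_of_le hi h)

theorem X_mem_headAlgebra {j : ℕ} (i : Fin n) (h : (i : ℕ) < j) :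
    (X i : MvPolynomial (Fin n) R) ∈ headAlgebra R n j :=
  Algebra.subset_adjoin ⟨i, h, rfl⟩

/-- For `j = 0` all variables are roots, so the coefficients are symmetric. Each further step
divides out a linear factor whose root lies in the larger algebra. -/
theorem coeff_tailPolynomial_mem {j : ℕ} (hj : j ≤ n) (k : ℕ) :
    (tailPolynomial R n j).coeff k ∈ headAlgebra R n j := by
  induction j generalizing k with
  | zero =>
    have hs : (tailPolynomial R n 0).coeff k ∈ symmetricSubalgebra (Fin n) R := by
      rw [mem_symmetricSubalgebra]
      intro e
      have := Polynomial.coeff_map (p := tailPolynomial R n 0)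
        (rename (R := R) e : MvPolynomial (Fin n) R →ₐ[R] _).toRingHom k
      rw [AlgHom.toRingHom_eq_coe, RingHom.coe_coe] at this
      rw [← this]
      congr 1
      simp only [tailPolynomial, zero_le, Finset.filter_true, Polynomial.map_prod,
        Polynomial.map_sub, Polynomial.map_X, Polynomial.map_C, RingHom.coe_coe, rename_X]
      exact Equiv.prod_comp e (fun i => Polynomial.X - Polynomial.C (X i : MvPolynomial (Fin n) R))
    exact (headAlgebra R n 0).algebraMap_mem ⟨_, hs⟩
  | succ j ih =>
    refine coeff_mem_of_X_sub_C_mul (headAlgebra R n (j + 1)).toSubring (x := X ⟨j, hj⟩)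
      (X_mem_headAlgebra R _ (Nat.lt_succ_self j)) (fun k => ?_) k
    rw [← tailPolynomial_succ]
    exact headAlgebra_mono R (Nat.le_succ j) (ih (by omega) k)

theorem monic_tailPolynomial (n j : ℕ) : (tailPolynomial R n j).Monic :=
  Polynomial.monic_prod_of_monic _ _ fun _ _ => Polynomial.monic_X_sub_C _

theorem natDegree_tailPolynomial [Nontrivial R] {j : ℕ} (hj : j ≤ n) :
    (tailPolynomial R n j).natDegree = n - j := by
  rw [tailPolynomial, Polynomial.natDegree_prod_of_monic _ _
    (fun _ _ => Polynomial.monic_X_sub_C _)]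
  simp only [Polynomial.natDegree_X_sub_C, Finset.sum_const, smul_eq_mul, mul_one]
  have : Finset.univ.filter (fun i : Fin n => j ≤ (i : ℕ)) =
      (Finset.univ.filter (fun i : Fin n => (i : ℕ) < j))ᶜ := by
    ext i; simp
  rw [this, Finset.card_compl, Fin.card_filter_val_lt, Fintype.card_fin]
  omega

/-- The span over the symmetric polynomials of the Artin monomials in the first `j` variables. -/
noncomputable def headSpan (n j : ℕ) :
    Submodule (symmetricSubalgebra (Fin n) R) (MvPolynomial (Fin n) R) :=
  Submodule.span _ ((fun a : ArtinIndex n => artinMonomial R a) ''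
    {a | ∀ i : Fin n, j ≤ (i : ℕ) → (a i : ℕ) = 0})

theorem mul_X_pow_mem_headSpan {j : ℕ} (hj : j < n) {l : ℕ} (hl : l < n - j)
    {p : MvPolynomial (Fin n) R} (hp : p ∈ headSpan R n j) :
    p * X ⟨j, hj⟩ ^ l ∈ headSpan R n (j + 1) := by
  induction hp using Submodule.span_induction with
  | zero => simp
  | add x y _ _ hx hy => rw [add_mul]; exact add_mem hx hy
  | smul c x _ hx => rw [smul_mul_assoc]; exact Submodule.smul_mem _ _ hx
  | mem x hx =>
    obtain ⟨a, ha, rfl⟩ := hx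
    refine Submodule.subset_span ⟨Function.update a ⟨j, hj⟩ ⟨l, hl⟩, ?_, ?_⟩
    · intro i hi
      rw [Function.update_of_ne (by rintro rfl; simp at hi)]
      exact ha i (by omega)
    · simp only [artinMonomial]
      rw [← Finset.mul_prod_erase _ _ (Finset.mem_univ ⟨j, hj⟩),
        ← Finset.mul_prod_erase _ (fun i => (X i : MvPolynomial (Fin n) R) ^ (a i : ℕ))
          (Finset.mem_univ ⟨j, hj⟩), Function.update_self, ha ⟨j, hj⟩ le_rfl, pow_zero, one_mul,
        mul_comm]
      congr 1
      refine Finset.prod_congr rfl fun i hi => ?_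
      rw [Function.update_of_ne (Finset.ne_of_mem_erase hi)]

/-- The variable of index `j` is a root of the tail polynomial, monic of degree `n - j` over the
algebra of the earlier variables, so its powers below `n - j` suffice. -/
theorem headAlgebra_le_headSpan [Nontrivial R] {j : ℕ} (hj : j ≤ n) :
    Subalgebra.toSubmodule (headAlgebra R n j) ≤ headSpan R n j := by
  induction j with
  | zero =>
    intro p hp
    have hp' : p ∈ headAlgebra R n 0 := hp
    simp only [headAlgebra, not_lt_zero, Set.ofPred_false, Set.image_empty,
      Algebra.adjoin_empty] at hp'
    obtain ⟨c, rfl⟩ := Algebra.mem_bot.1 hp'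
    rw [Algebra.algebraMap_eq_smul_one]
    refine Submodule.smul_mem _ _ (Submodule.subset_span ⟨fun i => ⟨0, by omega⟩, ?_, ?_⟩)
    · simp
    · simp [artinMonomial]
  | succ j ih =>
    intro p hp
    have hjn : j < n := hj
    have hd := natDegree_tailPolynomial R hjn.le
    obtain ⟨c, rfl⟩ := exists_eq_sum_of_mem_adjoin (headAlgebra R n j) (x := X ⟨j, hjn⟩) (y := p)
      (monic_tailPolynomial R n j) (coeff_tailPolynomial_mem R hjn.le) (by omega)
      (by rw [tailPolynomial_succ R hjn]; simp) (by
        refine Algebra.adjoin_mono ?_ hp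
        rintro _ ⟨i, hi, rfl⟩
        rcases Nat.lt_succ_iff_lt_or_eq.1 hi with h | h
        · exact Or.inl (X_mem_headAlgebra R i h)
        · right
          have : i = ⟨j, hjn⟩ := Fin.ext h
          simp [this])
    rw [hd]
    exact Submodule.sum_mem _ fun l hl =>
      mul_X_pow_mem_headSpan R hjn (Finset.mem_range.1 hl) (ih hjn.le (c l).2)

/-- The Artin monomials span the polynomial ring over the symmetric polynomials. -/
theorem span_artinMonomial [Nontrivial R] :
    Submodule.span (symmetricSubalgebra (Fin n) R) (Set.range (artinMonomial (n := n) R)) = ⊤ := by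
  rw [eq_top_iff]
  intro p _
  have hp : p ∈ headAlgebra R n n := by
    have : p ∈ Algebra.adjoin R (Set.range (X : Fin n → MvPolynomial (Fin n) R)) := by
      rw [adjoin_range_X]; trivial
    induction this using Algebra.adjoin_induction with
    | mem x hx => obtain ⟨i, rfl⟩ := hx; exact X_mem_headAlgebra R i i.2
    | algebraMap r =>
      rw [IsScalarTower.algebraMap_apply R (symmetricSubalgebra (Fin n) R)]
      exact Subalgebra.algebraMap_mem _ _
    | add x y _ _ hx hy => exact add_mem (hx trivial) (hy trivial)
    | mul x y _ _ hx hy => exact mul_mem (hx trivial) (hy trivial)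
  refine Submodule.span_mono ?_ (headAlgebra_le_headSpan R le_rfl hp)
  rintro _ ⟨a, _, rfl⟩
  exact ⟨a, rfl⟩

end Artin

/-! ### Evaluation at permuted points and linear independence -/

section Points

variable {n : ℕ} {E : Type*} [CommRing E]

/-- The values of the Artin monomials at a family of points indexed by permutations. -/
def pointMatrix (D : Equiv.Perm (Fin n) → Fin n → E) :
    Matrix (Equiv.Perm (Fin n)) (ArtinIndex n) E :=
  Matrix.of fun σ a => ∏ i, D σ i ^ (a i : ℕ)

theorem eval_artinMonomial (x : Fin n → E) (a : ArtinIndex n) :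
    eval x (artinMonomial E a) = ∏ i, x i ^ (a i : ℕ) := by
  simp [artinMonomial]

/-- Expand interpolation polynomials in Artin monomials with symmetric coefficients: these take the
same value at every permutation of `ν`, so the expansion is a right inverse. The inverses `r` are
explicit because `E` need not be a field; it is later `K[t]/(t³)`. -/
theorem exists_pointMatrix_mul_eq_one [Nontrivial E] (ν : Fin n → E) (r : Fin n → Fin n → E)
    (hr : ∀ p q, p ≠ q → r p q * (ν p - ν q) = 1) :
    ∃ C : Matrix (ArtinIndex n) (Equiv.Perm (Fin n)) E,
      pointMatrix (fun σ i => ν (σ i)) * C = 1 := by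
  -- A product of Lagrange factors, one for each coordinate: at the point of `τ` it vanishes as soon
  -- as `τ i ≠ σ i` for some `i`.
  let p : Equiv.Perm (Fin n) → MvPolynomial (Fin n) E := fun σ =>
    ∏ i, ∏ j ∈ Finset.univ.erase (σ i), C (r (σ i) j) * (X i - C (ν j))
  have hp : ∀ σ τ : Equiv.Perm (Fin n), eval (fun i => ν (τ i)) (p σ) = if τ = σ then 1 else 0 := by
    intro σ τ
    simp only [p, map_prod, map_mul, map_sub, eval_C, eval_X]
    split_ifs with h
    · subst h
      refine Finset.prod_eq_one fun i _ => Finset.prod_eq_one fun j hj => ?_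
      exact hr _ _ (Finset.ne_of_mem_erase hj).symm
    · obtain ⟨i, hi⟩ : ∃ i, τ i ≠ σ i := by
        by_contra! hc
        exact h (Equiv.ext hc)
      refine Finset.prod_eq_zero (Finset.mem_univ i) ?_
      refine Finset.prod_eq_zero (Finset.mem_erase.2 ⟨hi, Finset.mem_univ _⟩) ?_
      simp
  have hspan : ∀ σ, ∃ c : ArtinIndex n → symmetricSubalgebra (Fin n) E,
      ∑ a, c a • artinMonomial E a = p σ := by
    intro σ
    have : p σ ∈ Submodule.span (symmetricSubalgebra (Fin n) E)
        (Set.range (artinMonomial (n := n) E)) := by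
      rw [span_artinMonomial]; trivial
    exact (Submodule.mem_span_range_iff_exists_fun _).1 this
  choose c hc using hspan
  refine ⟨Matrix.of fun a σ => eval ν (c σ a : MvPolynomial (Fin n) E), ?_⟩
  ext τ σ
  rw [Matrix.one_apply, ← hp σ τ, ← hc σ, map_sum, Matrix.mul_apply]
  refine Finset.sum_congr rfl fun a _ => ?_
  rw [Subalgebra.smul_def, smul_eq_mul, map_mul, eval_artinMonomial, mul_comm]
  simp only [pointMatrix, Matrix.of_apply]
  congr 1
  have hsym : rename τ (c σ a : MvPolynomial (Fin n) E) = c σ a :=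
    (mem_symmetricSubalgebra _).1 (c σ a).2 τ
  have hev : eval (fun i => ν (τ i)) (c σ a : MvPolynomial (Fin n) E) =
      eval ν (rename τ (c σ a : MvPolynomial (Fin n) E)) := (eval_rename _ _ _).symm
  rw [hev, hsym]

/-- Permuting the variables in a relation leaves its symmetric coefficients unchanged. This gives
`n!` equations in `n!` unknowns, whose matrix is invertible over the fraction field. -/
theorem linearIndependent_artinMonomial (R : Type*) [CommRing R] [IsDomain R] :
    LinearIndependent (symmetricSubalgebra (Fin n) R) (artinMonomial (n := n) R) := by
  let S := MvPolynomial (Fin n) R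
  let L := FractionRing S
  let ν : Fin n → L := fun i => algebraMap S L (X i)
  have hν : ∀ p q, p ≠ q → (ν p - ν q)⁻¹ * (ν p - ν q) = 1 := by
    intro p q hpq
    refine inv_mul_cancel₀ ?_
    rw [sub_ne_zero]
    intro h
    exact hpq (X_injective (IsFractionRing.injective S L h))
  obtain ⟨C, hC⟩ := exists_pointMatrix_mul_eq_one ν _ hν
  have hcard : Fintype.card (Equiv.Perm (Fin n)) = Fintype.card (ArtinIndex n) := by
    rw [card_artinIndex, Fintype.card_perm, Fintype.card_fin]
  have hC' := (Matrix.mul_eq_one_comm_of_card_eq _ _ _ hcard).1 hC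
  rw [Fintype.linearIndependent_iff]
  intro c hc
  let v : ArtinIndex n → L := fun a => algebraMap S L (c a : S)
  have hBv : (pointMatrix (fun σ i => ν (σ i))).mulVec v = 0 := by
    funext σ
    have h := congrArg (fun p => algebraMap S L (rename σ p)) hc
    simp only [map_sum, Subalgebra.smul_def, smul_eq_mul, map_mul, map_zero] at h
    rw [Pi.zero_apply, ← h, Matrix.mulVec, dotProduct]
    refine Finset.sum_congr rfl fun a _ => ?_
    rw [(mem_symmetricSubalgebra _).1 (c a).2 σ, mul_comm]
    congr 1
    simp [pointMatrix, artinMonomial, ν]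
  have hv : v = 0 := by
    rw [← Matrix.one_mulVec v, ← hC', ← Matrix.mulVec_mulVec, hBv, Matrix.mulVec_zero]
  intro a
  have := congrFun hv a
  exact Subtype.ext (IsFractionRing.injective S L (this.trans (map_zero _).symm))

end Points

/-! ### A homogeneous basis from elementary symmetric polynomials -/

section Basis

variable (n : ℕ) (R : Type*) [CommRing R] [IsDomain R]

/-- The products of an Artin monomial and elementary symmetric polynomials form a basis. -/
noncomputable def esymmArtinBasis :
    Module.Basis ((Fin n →₀ ℕ) × ArtinIndex n) R (MvPolynomial (Fin n) R) :=
  ((basisMonomials (Fin n) R).map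
      (esymmAlgEquiv (Fin n) R (Fintype.card_fin n)).toLinearEquiv).smulTower
    (Module.Basis.mk (linearIndependent_artinMonomial R) (span_artinMonomial R).ge)

theorem esymmArtinBasis_apply (i : (Fin n →₀ ℕ) × ArtinIndex n) :
    esymmArtinBasis n R i = (∏ k : Fin n, esymm (Fin n) R (k + 1) ^ i.1 k) * artinMonomial R i.2 := by
  rw [esymmArtinBasis, Module.Basis.smulTower_apply, Module.Basis.mk_apply, Subalgebra.smul_def,
    smul_eq_mul, Module.Basis.map_apply, coe_basisMonomials]
  congr 1
  have h : ∀ p, ((esymmAlgEquiv (Fin n) R (Fintype.card_fin n) p :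
      symmetricSubalgebra (Fin n) R) : MvPolynomial (Fin n) R) =
        aeval (fun i : Fin n => esymm (Fin n) R (i + 1)) p := fun p =>
    esymmAlgHom_apply p
  change ((esymmAlgEquiv (Fin n) R (Fintype.card_fin n) (monomial i.1 1) :
      symmetricSubalgebra (Fin n) R) : MvPolynomial (Fin n) R) = _
  rw [h, aeval_monomial, map_one, one_mul, Finsupp.prod_fintype _ _ (by simp)]

end Basis

/-! ### Leading forms and lifting of bases -/

section LeadingForm

variable {σ R : Type*} [CommRing R]

variable (σ R) in
/-- The polynomials of total degree less than `m`. -/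
noncomputable def degreeLTSubmodule (m : ℕ) : Submodule R (MvPolynomial σ R) :=
  restrictSupport R {s | s.degree < m}

theorem mem_degreeLTSubmodule {m : ℕ} {p : MvPolynomial σ R} :
    p ∈ degreeLTSubmodule σ R m ↔ ∀ s, coeff s p ≠ 0 → s.degree < m := by
  rw [degreeLTSubmodule, mem_restrictSupport_iff]
  exact ⟨fun h s hs => h (mem_support_iff.2 hs), fun h s hs => h s (mem_support_iff.1 hs)⟩

theorem degreeLTSubmodule_mono {m m' : ℕ} (h : m ≤ m') :
    degreeLTSubmodule σ R m ≤ degreeLTSubmodule σ R m' :=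
  restrictSupport_mono _ fun _ hs => lt_of_lt_of_le hs h

theorem mul_mem_degreeLTSubmodule {m m' : ℕ} {p q : MvPolynomial σ R}
    (hp : p ∈ degreeLTSubmodule σ R m) (hq : q ∈ degreeLTSubmodule σ R (m' + 1)) :
    p * q ∈ degreeLTSubmodule σ R (m + m') := by
  classical
  rw [mem_degreeLTSubmodule] at *
  intro s hs
  obtain ⟨a, ha, b, hb, rfl⟩ := Finset.mem_add.1 (support_mul p q (mem_support_iff.2 hs))
  have h1 := hp a (mem_support_iff.1 ha)
  have h2 := hq b (mem_support_iff.1 hb)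
  rw [map_add]
  omega

theorem MvPolynomial.IsHomogeneous.mem_degreeLTSubmodule {m : ℕ} {p : MvPolynomial σ R}
    (hp : p.IsHomogeneous m) : p ∈ degreeLTSubmodule σ R (m + 1) := by
  rw [_root_.mem_degreeLTSubmodule]
  intro s hs
  by_contra h
  exact hs (hp.coeff_eq_zero (by omega))

theorem exists_mem_degreeLTSubmodule (p : MvPolynomial σ R) :
    ∃ m, p ∈ degreeLTSubmodule σ R m := by
  refine ⟨p.totalDegree + 1, mem_degreeLTSubmodule.2 fun s hs => ?_⟩
  have := le_totalDegree (mem_support_iff.2 hs)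
  exact Nat.lt_succ_of_le this

theorem eq_zero_of_mem_degreeLTSubmodule_zero {p : MvPolynomial σ R}
    (hp : p ∈ degreeLTSubmodule σ R 0) : p = 0 := by
  ext s
  rw [coeff_zero]
  by_contra h
  exact absurd (mem_degreeLTSubmodule.1 hp s h) (Nat.not_lt_zero _)

/-- `f` has leading form `e` in degree `w`. -/
def HasLeadingForm (w : ℕ) (f e : MvPolynomial σ R) : Prop :=
  e.IsHomogeneous w ∧ f - e ∈ degreeLTSubmodule σ R w

theorem MvPolynomial.IsHomogeneous.hasLeadingForm {w : ℕ} {e : MvPolynomial σ R}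
    (he : e.IsHomogeneous w) : HasLeadingForm w e e :=
  ⟨he, by rw [sub_self]; exact zero_mem _⟩

theorem HasLeadingForm.mul {w w' : ℕ} {f e f' e' : MvPolynomial σ R} (h : HasLeadingForm w f e)
    (h' : HasLeadingForm w' f' e') : HasLeadingForm (w + w') (f * f') (e * e') := by
  refine ⟨h.1.mul h'.1, ?_⟩
  have : f * f' - e * e' = (f - e) * (f' - e') + (f - e) * e' + (f' - e') * e := by ring
  rw [this]
  refine add_mem (add_mem ?_ ?_) ?_
  · exact mul_mem_degreeLTSubmodule h.2 (degreeLTSubmodule_mono (Nat.le_succ _) h'.2)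
  · exact mul_mem_degreeLTSubmodule h.2 h'.1.mem_degreeLTSubmodule
  · rw [add_comm w]
    exact mul_mem_degreeLTSubmodule h'.2 h.1.mem_degreeLTSubmodule

theorem HasLeadingForm.pow {w : ℕ} {f e : MvPolynomial σ R} (h : HasLeadingForm w f e) (k : ℕ) :
    HasLeadingForm (w * k) (f ^ k) (e ^ k) := by
  induction k with
  | zero => simpa using (isHomogeneous_one σ R).hasLeadingForm
  | succ k ih => rw [pow_succ, pow_succ, Nat.mul_succ]; exact ih.mul h

theorem HasLeadingForm.prod {ι : Type*} (s : Finset ι) {w : ι → ℕ} {f e : ι → MvPolynomial σ R}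
    (h : ∀ i ∈ s, HasLeadingForm (w i) (f i) (e i)) :
    HasLeadingForm (∑ i ∈ s, w i) (∏ i ∈ s, f i) (∏ i ∈ s, e i) := by
  classical
  induction s using Finset.induction_on with
  | empty => simpa using (isHomogeneous_one σ R).hasLeadingForm
  | insert a s ha ih =>
    rw [Finset.sum_insert ha, Finset.prod_insert ha, Finset.prod_insert ha]
    exact (h a (Finset.mem_insert_self _ _)).mul
      (ih fun i hi => h i (Finset.mem_insert_of_mem hi))

variable {ι : Type*} (b : Module.Basis ι R (MvPolynomial σ R)) (w : ι → ℕ)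

/-- Since the basis is homogeneous, projecting an expansion to degree `k` keeps exactly the terms of
weight `k`. -/
theorem mem_span_of_mem_degreeLTSubmodule (hb : ∀ i, (b i).IsHomogeneous (w i)) {m : ℕ}
    {p : MvPolynomial σ R} (hp : p ∈ degreeLTSubmodule σ R m) :
    p ∈ Submodule.span R (b '' {i | w i < m}) := by
  have hcomp : ∀ k, homogeneousComponent k p ∈ Submodule.span R (b '' {i | w i = k}) := by
    intro k
    have hp' : p ∈ Submodule.span R (Set.range b) := by rw [b.span_eq]; trivial
    clear hp
    induction hp' using Submodule.span_induction with
    | zero => rw [map_zero]; exact zero_mem _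
    | add x y _ _ hx hy => rw [map_add]; exact add_mem hx hy
    | smul c x _ hx => rw [map_smul]; exact Submodule.smul_mem _ _ hx
    | mem x hx =>
      obtain ⟨i, rfl⟩ := hx
      rw [homogeneousComponent_of_mem (hb i)]
      split_ifs with h
      · exact Submodule.subset_span ⟨i, h.symm, rfl⟩
      · exact zero_mem _
  rw [← sum_homogeneousComponent p]
  refine Submodule.sum_mem _ fun k hk => ?_
  by_cases hkm : k < m
  · exact Submodule.span_mono (Set.image_mono fun i (hi : w i = k) => hi.trans_lt hkm) (hcomp k)
  · rw [homogeneousComponent_eq_zero' k p]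
    · exact zero_mem _
    · intro s hs h
      have := mem_degreeLTSubmodule.1 hp s (mem_support_iff.1 hs)
      omega

/-- A family whose leading forms are a basis is itself a basis. -/
theorem exists_basis_of_hasLeadingForm (f : ι → MvPolynomial σ R)
    (hf : ∀ i, HasLeadingForm (w i) (f i) (b i)) :
    ∃ b' : Module.Basis ι R (MvPolynomial σ R), ∀ i, b' i = f i := by
  let N : MvPolynomial σ R →ₗ[R] MvPolynomial σ R := b.constr R fun i => f i - b i
  -- `N` strictly lowers the degree filtration, so `id + N` is bijective by induction on degree.
  have hN : ∀ m p, p ∈ degreeLTSubmodule σ R (m + 1) → N p ∈ degreeLTSubmodule σ R m := by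
    intro m p hp
    have := mem_span_of_mem_degreeLTSubmodule b w (fun i => (hf i).1) hp
    clear hp
    induction this using Submodule.span_induction with
    | zero => rw [map_zero]; exact zero_mem _
    | add x y _ _ hx hy => rw [map_add]; exact add_mem hx hy
    | smul c x _ hx => rw [map_smul]; exact Submodule.smul_mem _ _ hx
    | mem x hx =>
      obtain ⟨i, hi, rfl⟩ := hx
      rw [b.constr_basis]
      exact degreeLTSubmodule_mono (Nat.lt_succ_iff.1 hi) (hf i).2
  let ψ : MvPolynomial σ R →ₗ[R] MvPolynomial σ R := LinearMap.id + N
  have hinj : ∀ m p, p ∈ degreeLTSubmodule σ R m → ψ p = 0 → p = 0 := by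
    intro m
    induction m with
    | zero => exact fun p hp _ => eq_zero_of_mem_degreeLTSubmodule_zero hp
    | succ m ih =>
      intro p hp h
      refine ih p ?_ h
      have : p = - N p := eq_neg_of_add_eq_zero_left h
      rw [this]
      exact neg_mem (hN m p hp)
  have hsurj : ∀ m p, p ∈ degreeLTSubmodule σ R m → ∃ q, ψ q = p := by
    intro m
    induction m with
    | zero => exact fun p hp => ⟨0, by rw [map_zero, eq_zero_of_mem_degreeLTSubmodule_zero hp]⟩
    | succ m ih =>
      intro p hp
      obtain ⟨q, hq⟩ := ih _ (hN m p hp)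
      refine ⟨p - q, ?_⟩
      rw [map_sub, hq]
      exact add_sub_cancel_right _ _
  have hbij : Function.Bijective ψ := by
    refine ⟨(injective_iff_map_eq_zero ψ).2 fun p hp => ?_, fun p => ?_⟩
    · obtain ⟨m, hm⟩ := exists_mem_degreeLTSubmodule p
      exact hinj m p hm hp
    · obtain ⟨m, hm⟩ := exists_mem_degreeLTSubmodule p
      exact hsurj m p hm
  refine ⟨b.map (LinearEquiv.ofBijective ψ hbij), fun i => ?_⟩
  rw [b.map_apply, LinearEquiv.ofBijective_apply]
  change b i + N (b i) = f i
  rw [b.constr_basis]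
  exact add_sub_cancel _ _

end LeadingForm

/-! ### Leading forms of the characteristic coefficients -/

section CharacteristicCoefficients

variable {n : ℕ} {R : Type*} [CommRing R]

/-- The non-leading coefficients of the characteristic polynomial of `A - D` as polynomials in the
entries of the diagonal matrix `D`. -/
noncomputable def charCoeff (A : Matrix (Fin n) (Fin n) R) (k : Fin n) : MvPolynomial (Fin n) R :=
  (A.map C - Matrix.diagonal X).charpoly.coeff (n - (k + 1))

theorem eval₂_charCoeff {R' : Type*} [CommRing R'] (f : R →+* R')
    (A : Matrix (Fin n) (Fin n) R) (x : Fin n → R') (k : Fin n) :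
    eval₂ f x (charCoeff A k) = (A.map f - Matrix.diagonal x).charpoly.coeff (n - (k + 1)) := by
  have h : (A.map (C : R →+* MvPolynomial (Fin n) R) - Matrix.diagonal X).map (eval₂Hom f x) =
      A.map f - Matrix.diagonal x := by
    ext i j
    by_cases hij : i = j
    · subst hij; simp
    · simp [hij]
  rw [← h, Matrix.charpoly_map, Polynomial.coeff_map]
  rfl

/-- `p` has total degree less than `m` in the coefficients and the variable together. -/
def JointDegreeLT (m : ℕ) (p : Polynomial (MvPolynomial (Fin n) R)) : Prop :=
  ∀ j s, coeff s (p.coeff j) ≠ 0 → s.degree + j < m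

theorem JointDegreeLT.mono {m m' : ℕ} {p : Polynomial (MvPolynomial (Fin n) R)}
    (hp : JointDegreeLT m p) (h : m ≤ m') : JointDegreeLT m' p :=
  fun j s hs => (hp j s hs).trans_le h

theorem JointDegreeLT.add {m : ℕ} {p q : Polynomial (MvPolynomial (Fin n) R)}
    (hp : JointDegreeLT m p) (hq : JointDegreeLT m q) : JointDegreeLT m (p + q) := by
  intro j s hs
  rw [Polynomial.coeff_add, coeff_add] at hs
  by_cases h : coeff s (p.coeff j) = 0
  · exact hq j s (by rwa [h, zero_add] at hs)
  · exact hp j s h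

theorem JointDegreeLT.neg {m : ℕ} {p : Polynomial (MvPolynomial (Fin n) R)}
    (hp : JointDegreeLT m p) : JointDegreeLT m (-p) := by
  intro j s hs
  rw [Polynomial.coeff_neg, coeff_neg, neg_ne_zero] at hs
  exact hp j s hs

theorem JointDegreeLT.zero {m : ℕ} :
    JointDegreeLT m (0 : Polynomial (MvPolynomial (Fin n) R)) := by
  intro j s hs
  simp at hs

theorem JointDegreeLT.sum {ι : Type*} (s : Finset ι) {m : ℕ}
    {p : ι → Polynomial (MvPolynomial (Fin n) R)} (h : ∀ i ∈ s, JointDegreeLT m (p i)) :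
    JointDegreeLT m (∑ i ∈ s, p i) :=
  Finset.sum_induction _ _ (fun _ _ => JointDegreeLT.add) JointDegreeLT.zero h

theorem JointDegreeLT.mul {m m' : ℕ} {p q : Polynomial (MvPolynomial (Fin n) R)}
    (hp : JointDegreeLT m p) (hq : JointDegreeLT (m' + 1) q) : JointDegreeLT (m + m') (p * q) := by
  intro j s hs
  rw [Polynomial.coeff_mul, coeff_sum] at hs
  obtain ⟨⟨a, b⟩, hab, h⟩ := Finset.exists_ne_zero_of_sum_ne_zero hs
  rw [Finset.HasAntidiagonal.mem_antidiagonal] at hab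
  obtain ⟨x, hx, y, hy, rfl⟩ := Finset.mem_add.1 (support_mul _ _ (mem_support_iff.2 h))
  have h1 := hp a x (mem_support_iff.1 hx)
  have h2 := hq b y (mem_support_iff.1 hy)
  simp only at hab
  rw [map_add]
  omega

theorem JointDegreeLT.prod {ι : Type*} (s : Finset ι)
    {p : ι → Polynomial (MvPolynomial (Fin n) R)} (h : ∀ i ∈ s, JointDegreeLT 2 (p i)) :
    JointDegreeLT (s.card + 1) (∏ i ∈ s, p i) := by
  classical
  induction s using Finset.induction_on with
  | empty =>
    intro j t ht
    rw [Finset.prod_empty, Polynomial.coeff_one] at ht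
    split_ifs at ht with hj
    · rw [coeff_one] at ht
      split_ifs at ht with h0
      · subst hj h0; simp
      · exact absurd rfl ht
    · simp at ht
  | insert a s ha ih =>
    rw [Finset.prod_insert ha, Finset.card_insert_of_notMem ha, mul_comm]
    exact (ih fun i hi => h i (Finset.mem_insert_of_mem hi)).mul
      (h a (Finset.mem_insert_self _ _))

theorem jointDegreeLT_C_C (r : R) :
    JointDegreeLT 1 (Polynomial.C (C r) : Polynomial (MvPolynomial (Fin n) R)) := by
  intro j s hs
  rw [Polynomial.coeff_C] at hs
  split_ifs at hs with hj
  · rw [coeff_C] at hs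
    split_ifs at hs with h0
    · subst hj; rw [← h0]; simp
    · exact absurd rfl hs
  · simp at hs

theorem jointDegreeLT_X_add_C_X (i : Fin n) :
    JointDegreeLT 2 (Polynomial.X + Polynomial.C (X i) : Polynomial (MvPolynomial (Fin n) R)) := by
  refine JointDegreeLT.add ?_ ?_
  · intro j s hs
    rw [Polynomial.coeff_X] at hs
    split_ifs at hs with hj
    · rw [coeff_one] at hs
      split_ifs at hs with h0
      · subst hj; rw [← h0]; simp
      · exact absurd rfl hs
    · simp at hs
  · intro j s hs
    rw [Polynomial.coeff_C] at hs
    split_ifs at hs with hj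
    · rw [coeff_X] at hs
      split_ifs at hs with h0
      · subst hj; rw [← h0]; simp
      · exact absurd rfl hs
    · simp at hs

/-- In the Leibniz expansion the identity gives the subtracted product. Any other permutation uses
an off-diagonal entry, which is constant, so its term has joint degree below `n`. -/
theorem jointDegreeLT_charpoly_sub (A : Matrix (Fin n) (Fin n) R) (hA : ∀ i, A i i = 0) :
    JointDegreeLT n ((A.map C - Matrix.diagonal X).charpoly -
      ∏ i : Fin n, (Polynomial.X + Polynomial.C (X i : MvPolynomial (Fin n) R))) := by
  have hdiag : ∀ i, (A.map C - Matrix.diagonal X : Matrix _ _ (MvPolynomial (Fin n) R)).charmatrix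
      i i = Polynomial.X + Polynomial.C (X i) := by
    intro i
    simp [hA]
  have hoff : ∀ i j, i ≠ j →
      (A.map C - Matrix.diagonal X : Matrix _ _ (MvPolynomial (Fin n) R)).charmatrix i j =
        - Polynomial.C (C (A i j)) := by
    intro i j hij
    simp [hij]
  rw [Matrix.charpoly, Matrix.det_apply', ← Finset.add_sum_erase _ _ (Finset.mem_univ 1)]
  simp only [Equiv.Perm.sign_one, Units.val_one, Int.cast_one, one_mul, Equiv.Perm.one_apply]
  rw [Finset.prod_congr rfl fun i _ => hdiag i, add_sub_cancel_left]
  refine JointDegreeLT.sum _ fun τ hτ => ?_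
  obtain ⟨i, hi⟩ : ∃ i, τ i ≠ i := by
    by_contra! hc
    exact Finset.ne_of_mem_erase hτ (Equiv.ext hc)
  have hprod : JointDegreeLT n (∏ i, (A.map C - Matrix.diagonal X :
      Matrix _ _ (MvPolynomial (Fin n) R)).charmatrix (τ i) i) := by
    rw [← Finset.mul_prod_erase _ _ (Finset.mem_univ i), hoff _ _ hi, mul_comm]
    have h1 := JointDegreeLT.prod (Finset.univ.erase i) (p := fun j =>
      (A.map C - Matrix.diagonal X :
        Matrix _ _ (MvPolynomial (Fin n) R)).charmatrix (τ j) j) (fun j _ => by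
        by_cases hj : τ j = j
        · rw [hj, hdiag]; exact jointDegreeLT_X_add_C_X j
        · rw [hoff _ _ hj]; exact ((jointDegreeLT_C_C _).mono one_le_two).neg)
    rw [Finset.card_erase_of_mem (Finset.mem_univ i), Finset.card_univ, Fintype.card_fin] at h1
    have := h1.mul (m' := 0) (jointDegreeLT_C_C (n := n) (A (τ i) i)).neg
    have hn : 0 < n := i.pos
    rwa [add_zero, Nat.sub_add_cancel hn] at this
  rcases Int.units_eq_one_or (Equiv.Perm.sign τ) with h | h
  · rw [h]; simpa using hprod
  · rw [h]; simpa using hprod.neg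

theorem isHomogeneous_esymm {σ : Type*} [Fintype σ] (k : ℕ) : (esymm σ R k).IsHomogeneous k := by
  refine IsHomogeneous.sum _ _ _ fun t ht => ?_
  have := IsHomogeneous.prod t (X : σ → MvPolynomial σ R) (fun _ => 1)
    fun i _ => isHomogeneous_X R i
  rwa [Finset.sum_const, smul_eq_mul, mul_one, (Finset.mem_powersetCard.1 ht).2] at this

theorem hasLeadingForm_charCoeff (A : Matrix (Fin n) (Fin n) R) (hA : ∀ i, A i i = 0) (k : Fin n) :
    HasLeadingForm (k + 1) (charCoeff A k) (esymm (Fin n) R (k + 1)) := by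
  refine ⟨isHomogeneous_esymm (k + 1), mem_degreeLTSubmodule.2 fun s hs => ?_⟩
  have hk := k.2
  have he := prod_X_add_C_coeff (R := R) (σ := Fin n) (n - (k + 1)) (by simp)
  rw [Fintype.card_fin, Nat.sub_sub_self (by omega)] at he
  rw [← he, charCoeff, ← Polynomial.coeff_sub] at hs
  have := jointDegreeLT_charpoly_sub A hA _ s hs
  omega

theorem exists_basis_charCoeff [IsDomain R] (A : Matrix (Fin n) (Fin n) R) (hA : ∀ i, A i i = 0) :
    ∃ b : Module.Basis ((Fin n →₀ ℕ) × ArtinIndex n) R (MvPolynomial (Fin n) R),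
      ∀ i, b i = (∏ k, charCoeff A k ^ i.1 k) * artinMonomial R i.2 := by
  refine exists_basis_of_hasLeadingForm (esymmArtinBasis n R)
    (fun i => (∑ k : Fin n, (k + 1) * i.1 k) + ∑ k : Fin n, (i.2 k : ℕ)) _ fun i => ?_
  rw [esymmArtinBasis_apply]
  refine HasLeadingForm.mul (HasLeadingForm.prod _ fun k _ =>
    (hasLeadingForm_charCoeff A hA k).pow _) (IsHomogeneous.hasLeadingForm ?_)
  refine IsHomogeneous.prod _ _ _ fun k _ => ?_
  simpa using (isHomogeneous_X R k).pow (i.2 k : ℕ)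

end CharacteristicCoefficients

/-! ### Behaviour under scaling -/

theorem coeff_charpoly_smul {n : ℕ} {R : Type*} [CommRing R] {c c' : R} (hc : c * c' = 1)
    (B : Matrix (Fin n) (Fin n) R) (k : Fin n) :
    (c • B).charpoly.coeff (n - (k + 1)) = c ^ (k + 1 : ℕ) * B.charpoly.coeff (n - (k + 1)) := by
  have h : (c • B).charpoly.comp (Polynomial.C c * Polynomial.X) =
      Polynomial.C (c ^ n) * B.charpoly := by
    have h1 : (c • B).charmatrix.map
        (Polynomial.compRingHom (Polynomial.C c * Polynomial.X)) =
          Polynomial.C c • B.charmatrix := by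
      ext1 i j
      by_cases hij : i = j
      · subst hij; simp [mul_sub]
      · simp [hij]
    have h2 := RingHom.map_det (Polynomial.compRingHom (Polynomial.C c * Polynomial.X))
      (c • B).charmatrix
    rw [RingHom.mapMatrix_apply, h1, Matrix.det_smul, Fintype.card_fin, ← Polynomial.C_pow] at h2
    exact h2
  have h3 := congrArg (fun p => p.coeff (n - (k + 1))) h
  simp only [Polynomial.comp_C_mul_X_coeff, Polynomial.coeff_C_mul] at h3
  have hk := k.2
  have hpow : c ^ n = c ^ (n - (k + 1)) * c ^ (k + 1 : ℕ) := by rw [← pow_add]; congr 1; omega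
  calc _ = (c * c') ^ (n - (k + 1)) * (c • B).charpoly.coeff (n - (k + 1)) := by
        rw [hc, one_pow, one_mul]
    _ = c' ^ (n - (k + 1)) * ((c • B).charpoly.coeff (n - (k + 1)) * c ^ (n - (k + 1))) := by
        rw [mul_pow]; ring
    _ = (c * c') ^ (n - (k + 1)) * (c ^ (k + 1 : ℕ) * B.charpoly.coeff (n - (k + 1))) := by
        rw [h3, hpow, mul_pow]; ring
    _ = _ := by rw [hc, one_pow, one_mul]

theorem eval₂_C_mul_X_of_isHomogeneous {σ R : Type*} [Fintype σ] [CommRing R] (c : R)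
    {p : MvPolynomial σ R} {d : ℕ} (hp : p.IsHomogeneous d) :
    eval₂ C (fun i => C c * X i) p = C (c ^ d) * p := by
  have h := eval₂_eta p
  rw [eval₂_eq'] at h
  conv_rhs => rw [← h]
  rw [eval₂_eq', Finset.mul_sum]
  refine Finset.sum_congr rfl fun s hs => ?_
  have hs' : ∑ i, s i = d := by
    rw [← Finsupp.degree_eq_sum]
    by_contra hne
    exact mem_support_iff.1 hs (hp.coeff_eq_zero hne)
  rw [Finset.prod_congr rfl fun i _ => mul_pow (C c) (X i) (s i), Finset.prod_mul_distrib,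
    Finset.prod_pow_eq_pow_sum, hs', map_pow]
  ring

/-! ### Fibers of the characteristic polynomial and traces on them -/

section Fiber

variable {n : ℕ} {R : Type*} [CommRing R]

/-- The ideal of the scheme of diagonal matrices `D` for which `A - D` has the same
characteristic polynomial as `B`. -/
noncomputable def fiberIdeal (A B : Matrix (Fin n) (Fin n) R) : Ideal (MvPolynomial (Fin n) R) :=
  Ideal.span (Set.range fun k : Fin n => charCoeff A k - C (B.charpoly.coeff (n - (k + 1))))

theorem charCoeff_sub_mem (A B : Matrix (Fin n) (Fin n) R) (k : Fin n) :
    charCoeff A k - C (B.charpoly.coeff (n - (k + 1))) ∈ fiberIdeal A B :=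
  Ideal.subset_span ⟨k, rfl⟩

theorem eval_eq_zero_of_mem_fiberIdeal {A B : Matrix (Fin n) (Fin n) R} {x : Fin n → R}
    (hx : (A - Matrix.diagonal x).charpoly = B.charpoly) {p : MvPolynomial (Fin n) R}
    (hp : p ∈ fiberIdeal A B) : eval x p = 0 := by
  have hle : fiberIdeal A B ≤ RingHom.ker (eval x) := by
    refine Ideal.span_le.2 ?_
    rintro _ ⟨k, rfl⟩
    have h := eval₂_charCoeff (RingHom.id R) A x k
    rw [RingHom.coe_id, Matrix.map_id, hx] at h
    change eval x _ = 0
    rw [map_sub, eval_C, sub_eq_zero]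
    exact h
  exact hle hp

/-- Over a domain, the quotient by a fiber ideal is free on the Artin monomials. -/
theorem exists_normalForm [IsDomain R] (A B : Matrix (Fin n) (Fin n) R) (hA : ∀ i, A i i = 0) :
    ∃ ρ : MvPolynomial (Fin n) R →ₗ[R] (ArtinIndex n → R),
      (∀ p ∈ fiberIdeal A B, ρ p = 0) ∧
      (∀ a, ρ (artinMonomial R a) = Pi.single a 1) ∧
      ∀ p, p - ∑ a, C (ρ p a) * artinMonomial R a ∈ fiberIdeal A B := by
  obtain ⟨b, hb⟩ := exists_basis_charCoeff A hA
  let y : Fin n → R := fun k => B.charpoly.coeff (n - (k + 1))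
  -- Reduction modulo the ideal: each characteristic coefficient is replaced by its prescribed value
  -- `y k`.
  let ρ : MvPolynomial (Fin n) R →ₗ[R] (ArtinIndex n → R) :=
    b.constr R fun i => Pi.single i.2 (∏ k, y k ^ i.1 k)
  have hρ : ∀ i, ρ (b i) = Pi.single i.2 (∏ k, y k ^ i.1 k) := fun i => b.constr_basis _ _ _
  refine ⟨ρ, ?_, ?_, ?_⟩
  · have hgen : ∀ k, ∀ h, ρ (h * (charCoeff A k - C (y k))) = 0 := by
      intro k h
      have hh : h ∈ Submodule.span R (Set.range b) := by rw [b.span_eq]; trivial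
      induction hh using Submodule.span_induction with
      | zero => rw [zero_mul, map_zero]
      | add u v _ _ hu hv => rw [add_mul, map_add, hu, hv, add_zero]
      | smul c u _ hu => rw [smul_mul_assoc, map_smul, hu, smul_zero]
      | mem u hu =>
        obtain ⟨i, rfl⟩ := hu
        have h1 : b i * charCoeff A k = b (i.1 + Finsupp.single k 1, i.2) := by
          rw [hb, hb]
          simp only [Finsupp.add_apply, pow_add, Finset.prod_mul_distrib]
          have : ∏ j, charCoeff A j ^ (Finsupp.single k 1 : Fin n →₀ ℕ) j = charCoeff A k := by
            rw [Finset.prod_eq_single k]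
            · simp
            · intro j _ hj; simp [Finsupp.single_eq_of_ne hj]
            · simp
          rw [this]; ring
        have h2 : ∏ j, y j ^ (i.1 + Finsupp.single k 1 : Fin n →₀ ℕ) j = y k * ∏ j, y j ^ i.1 j := by
          simp only [Finsupp.add_apply, pow_add, Finset.prod_mul_distrib]
          have : ∏ j, y j ^ (Finsupp.single k 1 : Fin n →₀ ℕ) j = y k := by
            rw [Finset.prod_eq_single k]
            · simp
            · intro j _ hj; simp [Finsupp.single_eq_of_ne hj]
            · simp
          rw [this]; ring
        rw [mul_sub, h1, mul_comm (b i), ← smul_eq_C_mul, map_sub, map_smul, hρ, hρ, h2,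
          ← Pi.single_smul, smul_eq_mul, sub_self]
    intro p hp
    have h : ∀ h, ρ (h * p) = 0 := by
      refine Submodule.span_induction (p := fun p _ => ∀ h, ρ (h * p) = 0) ?_ ?_ ?_ ?_ hp
      · rintro _ ⟨k, rfl⟩ h
        exact hgen k h
      · intro h; rw [mul_zero, map_zero]
      · intro u v _ _ hu hv h; rw [mul_add, map_add, hu, hv, add_zero]
      · intro c u _ hu h; rw [smul_eq_mul, ← mul_assoc]; exact hu _
    simpa using h 1
  · intro a
    have h := hρ (0, a)
    rw [hb] at h
    simpa using h
  · intro p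
    have hp : p ∈ Submodule.span R (Set.range b) := by rw [b.span_eq]; trivial
    induction hp using Submodule.span_induction with
    | zero => simp
    | add u v _ _ hu hv =>
      have := add_mem hu hv
      convert this using 1
      simp only [map_add, Pi.add_apply, add_mul, Finset.sum_add_distrib]
      ring
    | smul c u _ hu =>
      have := Ideal.mul_mem_left _ (C c) hu
      convert this using 1
      have hs : ρ (c • u) = c • ρ u := map_smul ρ c u
      rw [mul_sub, Finset.mul_sum, hs, smul_eq_C_mul]
      congr 1
      refine Finset.sum_congr rfl fun a _ => ?_
      rw [Pi.smul_apply, smul_eq_mul, map_mul, mul_assoc]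
    | mem u hu =>
      obtain ⟨i, rfl⟩ := hu
      rw [hρ, Finset.sum_eq_single i.2, Pi.single_eq_same, hb, ← sub_mul]
      · refine Ideal.mul_mem_right _ _ ?_
        rw [← Ideal.Quotient.eq, map_prod, map_prod, map_prod]
        refine Finset.prod_congr rfl fun k _ => ?_
        rw [map_pow, map_pow, map_pow, Ideal.Quotient.eq.2 (charCoeff_sub_mem A B k)]
      · intro a _ ha
        rw [Pi.single_eq_of_ne ha, map_zero, zero_mul]
      · simp

/-- `M` describes multiplication by `g` on the Artin monomials modulo a fiber ideal. -/
def IsMulMatrix (A B : Matrix (Fin n) (Fin n) R) (g : MvPolynomial (Fin n) R)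
    (M : Matrix (ArtinIndex n) (ArtinIndex n) R) : Prop :=
  ∀ a, g * artinMonomial R a - ∑ b, C (M a b) * artinMonomial R b ∈ fiberIdeal A B

theorem exists_isMulMatrix [IsDomain R] (A B : Matrix (Fin n) (Fin n) R) (hA : ∀ i, A i i = 0)
    (g : MvPolynomial (Fin n) R) : ∃ M, IsMulMatrix A B g M := by
  obtain ⟨ρ, -, -, h⟩ := exists_normalForm A B hA
  exact ⟨Matrix.of fun a b => ρ (g * artinMonomial R a) b, fun a => h _⟩

theorem IsMulMatrix.unique [IsDomain R] {A B : Matrix (Fin n) (Fin n) R} (hA : ∀ i, A i i = 0)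
    {g : MvPolynomial (Fin n) R} {M N : Matrix (ArtinIndex n) (ArtinIndex n) R}
    (hM : IsMulMatrix A B g M) (hN : IsMulMatrix A B g N) : M = N := by
  obtain ⟨ρ, h0, h1, -⟩ := exists_normalForm A B hA
  have key : ∀ {L : Matrix (ArtinIndex n) (ArtinIndex n) R}, IsMulMatrix A B g L →
      ∀ a b, L a b = ρ (g * artinMonomial R a) b := by
    intro L hL a b
    have h := h0 _ (hL a)
    rw [map_sub, map_sum, sub_eq_zero] at h
    rw [h, Finset.sum_apply, Finset.sum_eq_single b]
    · rw [← smul_eq_C_mul, map_smul, h1]; simp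
    · intro c _ hc
      rw [← smul_eq_C_mul, map_smul, h1, Pi.smul_apply, Pi.single_eq_of_ne hc.symm, smul_zero]
    · simp
  ext a b
  rw [key hM, key hN]

theorem map_artinMonomial {R' : Type*} [CommRing R'] (f : R →+* R') (a : ArtinIndex n) :
    map f (artinMonomial R a) = artinMonomial R' a := by
  simp [artinMonomial]

/-- Base change allows one matrix over `K[t]` to be specialised at each `t` and also reduced modulo
`t³`. -/
theorem IsMulMatrix.map {R' : Type*} [CommRing R'] (f : R →+* R')
    {A B : Matrix (Fin n) (Fin n) R} {g : MvPolynomial (Fin n) R}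
    {M : Matrix (ArtinIndex n) (ArtinIndex n) R} (hM : IsMulMatrix A B g M) :
    IsMulMatrix (A.map f) (B.map f) (MvPolynomial.map f g) (M.map f) := by
  have hle : fiberIdeal A B ≤ (fiberIdeal (A.map f) (B.map f)).comap (MvPolynomial.map f) := by
    refine Ideal.span_le.2 ?_
    rintro _ ⟨k, rfl⟩
    have hk : MvPolynomial.map f (charCoeff A k) = charCoeff (A.map f) k := by
      have h := eval₂_charCoeff (C.comp f) A (X : Fin n → MvPolynomial (Fin n) R') k
      rw [← eval₂_map, eval₂_eta] at h
      rw [h, charCoeff, Matrix.map_map, RingHom.coe_comp]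
    change MvPolynomial.map f (charCoeff A k - C (B.charpoly.coeff (n - (k + 1)))) ∈
      fiberIdeal (A.map f) (B.map f)
    rw [map_sub, hk, map_C, ← Polynomial.coeff_map, ← Matrix.charpoly_map]
    exact charCoeff_sub_mem _ _ k
  intro a
  have := hle (hM a)
  rw [Ideal.mem_comap, map_sub, map_mul, map_sum, map_artinMonomial] at this
  simpa only [map_mul, map_C, map_artinMonomial, Matrix.map_apply] using this

theorem isMulMatrix_one (A B : Matrix (Fin n) (Fin n) R) : IsMulMatrix A B 1 1 := by
  intro a
  rw [Finset.sum_eq_single a]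
  · simp
  · intro b _ hb; rw [Matrix.one_apply_ne hb.symm, map_zero, zero_mul]
  · simp

/-- The factors are reversed because images of basis elements are stored as rows. -/
theorem IsMulMatrix.mul {A B : Matrix (Fin n) (Fin n) R} {g h : MvPolynomial (Fin n) R}
    {M N : Matrix (ArtinIndex n) (ArtinIndex n) R} (hM : IsMulMatrix A B g M)
    (hN : IsMulMatrix A B h N) : IsMulMatrix A B (g * h) (N * M) := by
  intro a
  have h1 := Ideal.mul_mem_left _ g (hN a)
  have h2 : ∑ b, C (N a b) * (g * artinMonomial R b - ∑ c, C (M b c) * artinMonomial R c) ∈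
      fiberIdeal A B := Ideal.sum_mem _ fun b _ => Ideal.mul_mem_left _ _ (hM b)
  have h3 := add_mem h1 h2
  convert h3 using 1
  have h4 : ∑ c, C ((N * M) a c) * artinMonomial R c =
      ∑ b, C (N a b) * ∑ c, C (M b c) * artinMonomial R c := by
    simp only [Matrix.mul_apply, map_sum, map_mul, Finset.sum_mul, Finset.mul_sum, mul_assoc]
    exact Finset.sum_comm
  rw [h4]
  simp only [mul_sub, Finset.sum_sub_distrib, Finset.mul_sum]
  rw [Finset.sum_congr rfl fun b _ => mul_left_comm g (C (N a b)) (artinMonomial R b)]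
  ring

theorem IsMulMatrix.pow {A B : Matrix (Fin n) (Fin n) R} {g : MvPolynomial (Fin n) R}
    {M : Matrix (ArtinIndex n) (ArtinIndex n) R} (hM : IsMulMatrix A B g M) (k : ℕ) :
    IsMulMatrix A B (g ^ k) (M ^ k) := by
  induction k with
  | zero => simpa using isMulMatrix_one A B
  | succ k ih => rw [pow_succ', pow_succ]; exact hM.mul ih

theorem isMulMatrix_zero_of_mem {A B : Matrix (Fin n) (Fin n) R} {g : MvPolynomial (Fin n) R}
    (hg : g ∈ fiberIdeal A B) : IsMulMatrix A B g 0 := by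
  intro a
  simpa using Ideal.mul_mem_right _ _ hg

theorem IsMulMatrix.trace_eq_zero_of_pow_mem [IsDomain R] {A B : Matrix (Fin n) (Fin n) R}
    (hA : ∀ i, A i i = 0) {g : MvPolynomial (Fin n) R}
    {M : Matrix (ArtinIndex n) (ArtinIndex n) R} (hM : IsMulMatrix A B g M) {k : ℕ}
    (hg : g ^ k ∈ fiberIdeal A B) : M.trace = 0 := by
  have h : M ^ k = 0 := (hM.pow k).unique hA (isMulMatrix_zero_of_mem hg)
  exact (Matrix.isNilpotent_trace_of_isNilpotent ⟨k, h⟩).eq_zero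

/-- The point matrix diagonalises multiplication by `g`, with the values of `g` as diagonal entries.
No domain hypothesis is imposed, so this applies modulo `t³`. -/
theorem IsMulMatrix.trace_eq_sum_eval {A B : Matrix (Fin n) (Fin n) R}
    {g : MvPolynomial (Fin n) R} {M : Matrix (ArtinIndex n) (ArtinIndex n) R}
    (hM : IsMulMatrix A B g M) {x : Equiv.Perm (Fin n) → Fin n → R}
    (hx : ∀ σ, (A - Matrix.diagonal (x σ)).charpoly = B.charpoly)
    {Q : Matrix (ArtinIndex n) (Equiv.Perm (Fin n)) R} (hQ : pointMatrix x * Q = 1) :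
    M.trace = ∑ σ, eval (x σ) g := by
  have hcard : Fintype.card (Equiv.Perm (Fin n)) = Fintype.card (ArtinIndex n) := by
    rw [card_artinIndex, Fintype.card_perm, Fintype.card_fin]
  have hQ' := (Matrix.mul_eq_one_comm_of_card_eq _ _ _ hcard).1 hQ
  have h : Matrix.diagonal (fun σ => eval (x σ) g) * pointMatrix x = pointMatrix x * M.transpose := by
    ext σ a
    have h1 := eval_eq_zero_of_mem_fiberIdeal (hx σ) (hM a)
    simp only [map_sub, map_mul, map_sum, eval_C, eval_artinMonomial] at h1
    rw [Matrix.diagonal_mul, Matrix.mul_apply]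
    simp only [pointMatrix, Matrix.of_apply, Matrix.transpose_apply]
    rw [sub_eq_zero.1 h1]
    exact Finset.sum_congr rfl fun b _ => mul_comm _ _
  calc M.trace = (M.transpose * (Q * pointMatrix x)).trace := by
        rw [hQ', mul_one, Matrix.trace_transpose]
    _ = (pointMatrix x * M.transpose * Q).trace := by
        rw [← Matrix.mul_assoc, Matrix.trace_mul_comm, ← Matrix.mul_assoc]
    _ = _ := by rw [← h, Matrix.mul_assoc, hQ, mul_one, Matrix.trace_diagonal]

/-- The dilation of `D` by `c` identifies the two fibers. It conjugates `M` by powers of `c` given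
by the monomial degrees, and homogeneity of `g` contributes `c ^ d`. -/
theorem IsMulMatrix.smul {c c' : R} (hc : c * c' = 1) {A B : Matrix (Fin n) (Fin n) R}
    {g : MvPolynomial (Fin n) R} {d : ℕ} (hg : g.IsHomogeneous d)
    {M : Matrix (ArtinIndex n) (ArtinIndex n) R} (hM : IsMulMatrix A B g M) :
    IsMulMatrix (c • A) (c • B) g (Matrix.of fun a b =>
      c ^ d * (c ^ (∑ i, (a i : ℕ)) * M a b * c' ^ (∑ i, (b i : ℕ)))) := by
  let φ : MvPolynomial (Fin n) R →+* MvPolynomial (Fin n) R :=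
    eval₂Hom C fun i => C c' * X i
  have hφC : ∀ r, φ (C r) = C r := fun r => eval₂Hom_C _ _ r
  have hφ : ∀ {p : MvPolynomial (Fin n) R} {d : ℕ}, p.IsHomogeneous d → φ p = C (c' ^ d) * p := by
    exact fun hp => eval₂_C_mul_X_of_isHomogeneous c' hp
  have hc' : c' * c = 1 := by rw [mul_comm, hc]
  have hb : ∀ a : ArtinIndex n, (artinMonomial R a).IsHomogeneous (∑ i, (a i : ℕ)) := by
    intro a
    refine IsHomogeneous.prod _ _ _ fun k _ => ?_
    simpa using (isHomogeneous_X R k).pow (a k : ℕ)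
  have hle : fiberIdeal A B ≤ (fiberIdeal (c • A) (c • B)).comap φ := by
    refine Ideal.span_le.2 ?_
    rintro _ ⟨k, rfl⟩
    have hk : φ (charCoeff A k) = C (c' ^ (k + 1 : ℕ)) * charCoeff (c • A) k := by
      have h1 := eval₂_charCoeff C A (fun i => C c' * X i) k
      have h2 : A.map C - Matrix.diagonal (fun i => C c' * X i : Fin n → MvPolynomial (Fin n) R) =
          (C c' : MvPolynomial (Fin n) R) • ((c • A).map C - Matrix.diagonal X) := by
        ext1 i j
        by_cases hij : i = j
        · subst hij
          simp only [Matrix.sub_apply, Matrix.map_apply, Matrix.diagonal_apply_eq,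
            Matrix.smul_apply, smul_eq_mul, mul_sub, ← map_mul, ← mul_assoc, hc', one_mul]
        · simp only [Matrix.sub_apply, Matrix.map_apply, Matrix.diagonal_apply_ne _ hij,
            Matrix.smul_apply, smul_eq_mul, sub_zero, ← map_mul, ← mul_assoc, hc', one_mul]
      rw [h2, coeff_charpoly_smul (c' := C c) (by rw [← map_mul, hc', map_one]), ← map_pow] at h1
      exact h1
    change φ (charCoeff A k - C (B.charpoly.coeff (n - (k + 1)))) ∈ fiberIdeal (c • A) (c • B)
    rw [map_sub, hk, hφC]
    have h3 : B.charpoly.coeff (n - (k + 1)) =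
        c' ^ (k + 1 : ℕ) * (c • B).charpoly.coeff (n - (k + 1)) := by
      rw [coeff_charpoly_smul hc, ← mul_assoc, ← mul_pow, hc', one_pow, one_mul]
    rw [h3, map_mul, ← mul_sub]
    exact Ideal.mul_mem_left _ _ (charCoeff_sub_mem _ _ k)
  intro a
  have h := Ideal.mul_mem_left _ (C (c ^ d * c ^ (∑ i, (a i : ℕ)))) (Ideal.mem_comap.1 (hle (hM a)))
  convert h using 1
  rw [map_sub φ, map_mul φ, map_sum φ, hφ hg, hφ (hb a), mul_sub, Finset.mul_sum]
  congr 1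
  · have : C (c ^ d * c ^ (∑ i, (a i : ℕ))) * (C (c' ^ d) * g *
        (C (c' ^ (∑ i, (a i : ℕ))) * artinMonomial R a)) =
        C ((c * c') ^ d * (c * c') ^ (∑ i, (a i : ℕ))) * (g * artinMonomial R a) := by
      simp only [map_mul, map_pow, mul_pow]; ring
    rw [this, hc]; simp
  · refine Finset.sum_congr rfl fun b _ => ?_
    rw [map_mul φ, hφC, hφ (hb b), Matrix.of_apply]
    simp only [map_mul, map_pow]; ring

theorem trace_scaled {c c' : R} (hc : c * c' = 1) (d : ℕ)
    (M : Matrix (ArtinIndex n) (ArtinIndex n) R) :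
    (Matrix.of fun a b : ArtinIndex n =>
      c ^ d * (c ^ (∑ i, (a i : ℕ)) * M a b * c' ^ (∑ i, (b i : ℕ)))).trace = c ^ d * M.trace := by
  rw [Matrix.trace, Matrix.trace, Finset.mul_sum]
  refine Finset.sum_congr rfl fun a _ => ?_
  rw [Matrix.diag_apply, Matrix.of_apply, Matrix.diag_apply, mul_right_comm (c ^ _) (M a a),
    ← mul_pow, hc, one_pow, one_mul]

end Fiber

/-! ### Second-order perturbation and sums over permutations -/

section Perturbation

variable {n : ℕ} {E : Type*} [CommRing E]

/-- The second-order correction of the diagonal matrix with eigenvalues fixed, where `r i j`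
stands for the inverse of the difference of the `i`-th and `j`-th eigenvalue. -/
def secondOrderShift (A r : Matrix (Fin n) (Fin n) E) (i : Fin n) : E :=
  -∑ j, A i j * A j i * r i j

/-- Eigenvalue perturbation to second order in a parameter with vanishing cube. -/
theorem charpoly_smul_sub_diagonal (A r : Matrix (Fin n) (Fin n) E) (hA : ∀ i, A i i = 0)
    {u : E} (hu : u ^ 3 = 0) (μ ν : Fin n → E) (hr : ∀ i j, i ≠ j → r i j * (μ i - μ j) = 1)
    (hν : ∀ i, u * ν i = u * μ i) :
    (u • A - Matrix.diagonal (fun i => ν i + u ^ 2 * secondOrderShift A r i)).charpoly =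
      ∏ i, (Polynomial.X + Polynomial.C (ν i)) := by
  -- The columns of `P` are eigenvectors of `B` with diagonal entries normalised to 1; `Z` and `Y`
  -- solve `B * P = P * N` off the diagonal at orders `u` and `u²`. The diagonal at order `u²`
  -- forces the shift.
  let Z : Matrix (Fin n) (Fin n) E := Matrix.of fun i j => A i j * r i j
  let Y : Matrix (Fin n) (Fin n) E := Matrix.of fun i j => if i = j then 0 else r i j * (A * Z) i j
  let P : Matrix (Fin n) (Fin n) E := 1 + u • (Z + u • Y)
  have hP : IsUnit P := by
    refine IsNilpotent.isUnit_one_add ⟨3, ?_⟩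
    rw [smul_pow, hu, zero_smul]
  let B := u • A - Matrix.diagonal (fun i => ν i + u ^ 2 * secondOrderShift A r i)
  let N := Matrix.diagonal (fun i => -ν i)
  have hAZ : ∀ i, (A * Z) i i = secondOrderShift A r i := by
    intro i
    rw [Matrix.mul_apply, secondOrderShift, ← Finset.sum_neg_distrib]
    refine Finset.sum_congr rfl fun j _ => ?_
    simp only [Z, Matrix.of_apply]
    by_cases hij : i = j
    · subst hij; simp [hA]
    · have h1 := hr i j hij
      have h2 := hr j i (Ne.symm hij)
      have h3 : r j i = - r i j := by
        calc r j i = r j i * (r i j * (μ i - μ j)) := by rw [h1, mul_one]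
          _ = - (r j i * (μ j - μ i)) * r i j := by ring
          _ = _ := by rw [h2]; ring
      rw [h3]; ring
  have hBP : B * P = P * N := by
    ext i j
    have e1 : (B * P) i j = u * A i j + u ^ 2 * (A * Z) i j + u ^ 3 * (A * Y) i j -
        (ν i + u ^ 2 * secondOrderShift A r i) * P i j := by
      simp only [B, Matrix.sub_mul, Matrix.sub_apply, Matrix.diagonal_mul]
      congr 1
      simp only [P, Matrix.mul_add, Matrix.mul_one, Matrix.smul_mul, Matrix.mul_smul,
        Matrix.add_apply, Matrix.smul_apply, smul_eq_mul]
      ring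
    rw [e1, Matrix.mul_diagonal, hu]
    by_cases hij : i = j
    · subst hij
      have hPii : P i i = 1 := by simp [P, Y, Z, hA]
      rw [hPii, hAZ, hA]
      ring
    · have hPij : P i j = u * (A i j * r i j) + u ^ 2 * (r i j * (A * Z) i j) := by
        simp [P, Y, Z, hij]; ring
      have h1 := hr i j hij
      have hνi := hν i
      have hνj := hν j
      rw [hPij]
      have h2 : u * (ν i - ν j) * r i j = u := by
        rw [mul_sub, hνi, hνj, ← mul_sub, mul_assoc, mul_comm (μ i - μ j), h1, mul_one]
      linear_combination (-A i j - u * (A * Z) i j) * h2 -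
        (secondOrderShift A r i * (A i j * r i j) + u * secondOrderShift A r i *
          (r i j * (A * Z) i j)) * hu
  obtain ⟨Q, hQ⟩ := hP
  have hB : B = P * (N * (Q⁻¹ : (Matrix (Fin n) (Fin n) E)ˣ)) := by
    rw [← Matrix.mul_assoc, ← hBP, ← hQ, Matrix.mul_assoc, Units.mul_inv, Matrix.mul_one]
  change B.charpoly = _
  rw [hB, Matrix.charpoly_mul_comm, Matrix.mul_assoc, ← hQ, Units.inv_mul, Matrix.mul_one,
    Matrix.charpoly_diagonal]
  simp

/-- Composing with the transposition of `j` and `k` changes the sign of each term. -/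
theorem sum_perm_mul_reciprocal_eq_zero (μ : Fin n → E) (r : Matrix (Fin n) (Fin n) E)
    (hr : ∀ p q, p ≠ q → r q p = - r p q) {i j k : Fin n} (hij : i ≠ j) (hik : i ≠ k) (hjk : j ≠ k) :
    ∑ σ : Equiv.Perm (Fin n), μ (σ i) * r (σ j) (σ k) = 0 := by
  refine Finset.sum_involution (fun σ _ => σ * Equiv.swap j k) ?_ ?_ ?_ ?_
  · intro σ _
    simp only [Equiv.Perm.mul_apply, Equiv.swap_apply_left, Equiv.swap_apply_right,
      Equiv.swap_apply_of_ne_of_ne hij hik]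
    rw [hr (σ j) (σ k) (fun h => hjk (σ.injective h))]
    ring
  · intro σ _ _ h
    have h1 : Equiv.swap j k = 1 := by simpa using h
    exact hjk (Equiv.swap_eq_one_iff.1 h1)
  · intro σ _; exact Finset.mem_univ _
  · intro σ _; simp [mul_assoc]

/-- In each shift only the term joining `i` and `j` survives summation over `σ`. The two survivors
combine through `μ p * r q p + μ q * r p q = -1`, so the answer no longer depends on `μ`. -/
theorem sum_perm_mul_shift (A r : Matrix (Fin n) (Fin n) E) (hA : ∀ i, A i i = 0)
    (hsymm : ∀ i j, A i j = A j i) (μ : Fin n → E)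
    (hr : ∀ p q, p ≠ q → r p q * (μ p - μ q) = 1) {i j : Fin n} (hij : i ≠ j) :
    ∑ σ : Equiv.Perm (Fin n),
      (μ (σ i) * secondOrderShift A (Matrix.of fun p q => r (σ p) (σ q)) j +
        μ (σ j) * secondOrderShift A (Matrix.of fun p q => r (σ p) (σ q)) i) =
      (n.factorial : E) * A i j ^ 2 := by
  have hanti : ∀ p q, p ≠ q → r q p = - r p q := by
    intro p q hpq
    have h1 := hr p q hpq
    have h2 := hr q p (Ne.symm hpq)
    calc r q p = r q p * (r p q * (μ p - μ q)) := by rw [h1, mul_one]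
      _ = - (r q p * (μ q - μ p)) * r p q := by ring
      _ = _ := by rw [h2]; ring
  have key : ∀ i j : Fin n, i ≠ j →
      ∑ σ : Equiv.Perm (Fin n),
        μ (σ i) * secondOrderShift A (Matrix.of fun p q => r (σ p) (σ q)) j =
      - (A i j ^ 2 * ∑ σ : Equiv.Perm (Fin n), μ (σ i) * r (σ j) (σ i)) := by
    intro i j hij
    have h : ∀ σ : Equiv.Perm (Fin n),
        μ (σ i) * secondOrderShift A (Matrix.of fun p q => r (σ p) (σ q)) j =
          - ∑ k, A j k ^ 2 * (μ (σ i) * r (σ j) (σ k)) := by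
      intro σ
      rw [secondOrderShift, mul_neg, Finset.mul_sum]
      congr 1
      refine Finset.sum_congr rfl fun k _ => ?_
      rw [Matrix.of_apply, hsymm k j]; ring
    rw [Finset.sum_congr rfl fun σ _ => h σ, Finset.sum_neg_distrib, Finset.sum_comm]
    congr 1
    rw [Finset.sum_eq_single i]
    · rw [← Finset.mul_sum, hsymm j i]
    · intro k _ hk
      rw [← Finset.mul_sum]
      by_cases hjk : j = k
      · subst hjk; rw [hA]; ring
      · rw [sum_perm_mul_reciprocal_eq_zero μ r hanti hij (Ne.symm hk) hjk, mul_zero]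
    · simp
  rw [Finset.sum_add_distrib, key i j hij, key j i hij.symm, hsymm j i, ← neg_add, ← mul_add,
    ← Finset.sum_add_distrib]
  have h : ∀ σ : Equiv.Perm (Fin n),
      μ (σ i) * r (σ j) (σ i) + μ (σ j) * r (σ i) (σ j) = -1 := by
    intro σ
    have hne : σ i ≠ σ j := fun h => hij (σ.injective h)
    rw [hanti _ _ hne]
    linear_combination - hr _ _ hne
  rw [Finset.sum_congr rfl fun σ _ => h σ, Finset.sum_const, Finset.card_univ, Fintype.card_perm,
    Fintype.card_fin, nsmul_eq_mul]
  ring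

theorem sum_perm_apply_pair_eq {M : Type*} [AddCommMonoid M] (f : Fin n → Fin n → M)
    {i j k l : Fin n} (hij : i ≠ j) (hkl : k ≠ l) :
    ∑ σ : Equiv.Perm (Fin n), f (σ i) (σ j) = ∑ σ : Equiv.Perm (Fin n), f (σ k) (σ l) := by
  obtain ⟨π, hi, hj⟩ : ∃ π : Equiv.Perm (Fin n), π i = k ∧ π j = l := by
    refine ⟨Equiv.swap (Equiv.swap i k j) l * Equiv.swap i k, ?_, ?_⟩
    · rw [Equiv.Perm.mul_apply, Equiv.swap_apply_left]
      refine Equiv.swap_apply_of_ne_of_ne ?_ hkl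
      intro h
      have : Equiv.swap i k i = Equiv.swap i k j := by rw [Equiv.swap_apply_left]; exact h
      exact hij ((Equiv.swap i k).injective this)
    · rw [Equiv.Perm.mul_apply, Equiv.swap_apply_left]
  rw [← Equiv.sum_comp (Equiv.mulRight π) (fun σ : Equiv.Perm (Fin n) => f (σ i) (σ j))]
  simp [hi, hj]

end Perturbation

/-- The points `D σ` all lie in the fiber, and their point matrix is invertible, being a nilpotent
perturbation of that of the permutations of `μ`. The trace is therefore the sum of the values of the
polynomial at these points. -/
theorem trace_eq_of_isMulMatrix_of_cube_eq_zero {n : ℕ} {E : Type*} [CommRing E] [Nontrivial E]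
    (A r : Matrix (Fin n) (Fin n) E) (hA : ∀ i, A i i = 0) (hsymm : ∀ i j, A i j = A j i)
    {u : E} (hu : u ^ 3 = 0) (μ : Fin n → E) (hr : ∀ i j, i ≠ j → r i j * (μ i - μ j) = 1)
    {i j k l : Fin n} (hij : i ≠ j) (hkl : k ≠ l)
    {M : Matrix (ArtinIndex n) (ArtinIndex n) E}
    (hM : IsMulMatrix (u • A) (u • A - Matrix.diagonal μ) (X i * X j - X k * X l) M) :
    M.trace = u ^ 2 * (n.factorial * (A i j ^ 2 - A k l ^ 2)) := by
  have hu4 : u ^ 4 = 0 := by rw [pow_succ, hu, zero_mul]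
  -- The correction in `ν` makes the point of the identity permutation exactly `μ`, so that the
  -- fiber is the prescribed one.
  let ν : Fin n → E := fun p => μ p - u ^ 2 * secondOrderShift A r p
  let c : Equiv.Perm (Fin n) → Fin n → E := fun σ =>
    secondOrderShift A (Matrix.of fun p q => r (σ p) (σ q))
  let D : Equiv.Perm (Fin n) → Fin n → E := fun σ p => ν (σ p) + u ^ 2 * c σ p
  have hν : ∀ p, u * ν p = u * μ p := by
    intro p
    simp only [ν]
    linear_combination (-secondOrderShift A r p) * hu
  have hD : ∀ σ, (u • A - Matrix.diagonal (D σ)).charpoly =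
      ∏ p, (Polynomial.X + Polynomial.C (ν p)) := by
    intro σ
    have := charpoly_smul_sub_diagonal A (Matrix.of fun p q => r (σ p) (σ q)) hA hu
      (fun p => μ (σ p)) (fun p => ν (σ p))
      (fun p q hpq => hr _ _ fun h => hpq (σ.injective h)) fun p => hν _
    rw [← Equiv.prod_comp σ (fun p => Polynomial.X + Polynomial.C (ν p))]
    exact this
  have hD1 : D 1 = μ := by
    funext p
    simp only [D, c, ν, Equiv.Perm.one_apply]
    exact sub_add_cancel _ _
  have hDB : ∀ σ, (u • A - Matrix.diagonal (D σ)).charpoly =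
      (u • A - Matrix.diagonal μ).charpoly := by
    intro σ
    rw [hD σ, ← hD 1, hD1]
  obtain ⟨Q₀, hQ₀⟩ := exists_pointMatrix_mul_eq_one μ r hr
  have hcongr : ∀ σ a, ∃ t, pointMatrix D σ a =
      pointMatrix (fun σ p => μ (σ p)) σ a + u ^ 2 * t := by
    intro σ a
    have h : pointMatrix D σ a - pointMatrix (fun σ p => μ (σ p)) σ a ∈ Ideal.span {u ^ 2} := by
      rw [← Ideal.Quotient.eq]
      simp only [pointMatrix, Matrix.of_apply, map_prod, map_pow]
      refine Finset.prod_congr rfl fun p _ => ?_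
      congr 1
      rw [Ideal.Quotient.eq, Ideal.mem_span_singleton]
      refine ⟨c σ p - secondOrderShift A r (σ p), ?_⟩
      simp only [D, ν]
      ring
    obtain ⟨t, ht⟩ := Ideal.mem_span_singleton.1 h
    exact ⟨t, by rw [← ht]; ring⟩
  choose T hT using hcongr
  obtain ⟨Q, hQ⟩ : ∃ Q : Matrix (ArtinIndex n) (Equiv.Perm (Fin n)) E, pointMatrix D * Q = 1 := by
    have h1 : pointMatrix D * Q₀ = 1 + u ^ 2 • (Matrix.of T * Q₀) := by
      have h2 : pointMatrix D = pointMatrix (fun σ p => μ (σ p)) + u ^ 2 • Matrix.of T := by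
        ext σ a
        exact hT σ a
      rw [h2, Matrix.add_mul, hQ₀, Matrix.smul_mul]
    have h3 : IsUnit (1 + u ^ 2 • (Matrix.of T * Q₀)) := by
      refine IsNilpotent.isUnit_one_add ⟨2, ?_⟩
      rw [smul_pow, ← pow_mul, hu4, zero_smul]
    obtain ⟨W, hW⟩ := h3
    refine ⟨Q₀ * (W⁻¹).val, ?_⟩
    rw [← Matrix.mul_assoc, h1, ← hW, Units.mul_inv]
  rw [hM.trace_eq_sum_eval hDB hQ]
  have hprod : ∀ (σ : Equiv.Perm (Fin n)) (p q : Fin n), D σ p * D σ q =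
      ν (σ p) * ν (σ q) + u ^ 2 * (μ (σ p) * c σ q + μ (σ q) * c σ p) := by
    intro σ p q
    simp only [D]
    linear_combination (u * c σ q) * hν (σ p) + (u * c σ p) * hν (σ q) + (c σ p * c σ q) * hu4
  simp only [map_sub, map_mul, eval_X, hprod]
  -- The sums of `ν (σ p) * ν (σ q)` do not depend on the pair and cancel, leaving only order `u²`.
  rw [Finset.sum_sub_distrib, Finset.sum_add_distrib, Finset.sum_add_distrib, ← Finset.mul_sum,
    ← Finset.mul_sum, sum_perm_mul_shift A r hA hsymm μ hr hij,
    sum_perm_mul_shift A r hA hsymm μ hr hkl,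
    sum_perm_apply_pair_eq (fun p q => ν p * ν q) hij hkl]
  ring

/-- After clearing denominators, `p` is `X ^ d` times the reversal of `q`, up to a power of `X`. -/
theorem coeff_eq_of_eval_eq_pow_mul_eval_inv {K : Type*} [Field K] [Infinite K]
    (p q : Polynomial K) (d : ℕ) (h : ∀ t ≠ 0, p.eval t = t ^ d * q.eval t⁻¹) :
    p.coeff d = q.coeff 0 := by
  have heq : Polynomial.X ^ q.natDegree * p = Polynomial.X ^ d * q.reverse := by
    refine Polynomial.eq_of_infinite_eval_eq _ _
      (Set.Infinite.mono ?_ (Set.finite_singleton (0 : K)).infinite_compl)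
    intro t ht
    have ht0 : t ≠ 0 := ht
    let := invertibleOfNonzero (inv_ne_zero ht0)
    have hrev := Polynomial.eval₂_reverse_mul_pow (RingHom.id K) t⁻¹ q
    rw [invOf_eq_inv, inv_inv, Polynomial.eval₂_id, Polynomial.eval₂_id] at hrev
    change (Polynomial.X ^ q.natDegree * p).eval t = (Polynomial.X ^ d * q.reverse).eval t
    simp only [Polynomial.eval_mul, Polynomial.eval_pow, Polynomial.eval_X]
    have hinv : t ^ q.natDegree * t⁻¹ ^ q.natDegree = 1 := by
      rw [← mul_pow, mul_inv_cancel₀ ht0, one_pow]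
    rw [h t ht0, ← hrev]
    linear_combination (t ^ d * q.reverse.eval t) * hinv
  have h1 := congrArg (fun f => Polynomial.coeff f (q.natDegree + d)) heq
  rw [add_comm q.natDegree d, Polynomial.coeff_X_pow_mul, add_comm d, Polynomial.coeff_X_pow_mul,
    Polynomial.coeff_reverse, Polynomial.revAt_le le_rfl, Nat.sub_self] at h1
  exact h1

/-! ### Uniqueness of the fiber forces equal squares -/

section Core

variable {K : Type*} [Field K] [IsAlgClosed K] {n : ℕ}

/-- By the Nullstellensatz, since the zero locus of the ideal contains at most the origin. -/
theorem exists_pow_mem_fiberIdeal (A : Matrix (Fin n) (Fin n) K)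
    (huniq : ∀ x, (A - Matrix.diagonal x).charpoly = A.charpoly → x = 0)
    {g : MvPolynomial (Fin n) K} (hg : eval 0 g = 0) : ∃ m, g ^ m ∈ fiberIdeal A A := by
  have h : g ∈ (fiberIdeal A A).radical := by
    rw [← vanishingIdeal_zeroLocus_eq_radical (K := K), mem_vanishingIdeal_iff]
    intro x hx
    have hx' : ∀ k : Fin n, (A - Matrix.diagonal x).charpoly.coeff (n - (k + 1)) =
        A.charpoly.coeff (n - (k + 1)) := by
      intro k
      have h1 := hx _ (charCoeff_sub_mem A A k)
      have h2 := eval₂_charCoeff (RingHom.id K) A x k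
      rw [RingHom.coe_id, Matrix.map_id] at h2
      rw [map_sub, aeval_C, sub_eq_zero] at h1
      rw [← h2]
      exact h1
    have hx0 : x = 0 := by
      refine huniq x (Polynomial.ext fun m => ?_)
      rcases lt_trichotomy m n with hm | hm | hm
      · have := hx' ⟨n - (m + 1), by omega⟩
        have he : n - (n - (m + 1) + 1) = m := by omega
        simpa only [he] using this
      · subst hm
        have hmonic : ∀ B : Matrix (Fin m) (Fin m) K, B.charpoly.coeff m = 1 := by
          intro B
          have := B.charpoly_monic.coeff_natDegree
          rwa [Matrix.charpoly_natDegree_eq_dim, Fintype.card_fin] at this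
        rw [hmonic, hmonic]
      · have hlarge : ∀ B : Matrix (Fin n) (Fin n) K, B.charpoly.coeff m = 0 := by
          intro B
          refine Polynomial.coeff_eq_zero_of_natDegree_lt ?_
          rwa [Matrix.charpoly_natDegree_eq_dim, Fintype.card_fin]
        rw [hlarge, hlarge]
    rw [hx0]
    exact hg
  exact h

theorem sq_eq_sq_of_unique_fiber (hn : (n.factorial : K) ≠ 0) (A : Matrix (Fin n) (Fin n) K)
    (hA : ∀ i, A i i = 0) (hsymm : ∀ i j, A i j = A j i)
    (huniq : ∀ x, (A - Matrix.diagonal x).charpoly = A.charpoly → x = 0)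
    {i j k l : Fin n} (hij : i ≠ j) (hkl : k ≠ l) : A i j ^ 2 = A k l ^ 2 := by
  have : Infinite K := IsAlgClosed.instInfinite
  obtain ⟨μ, hμ⟩ : ∃ μ : Fin n → K, ∀ p q, p ≠ q → μ p - μ q ≠ 0 := by
    refine ⟨fun p => Infinite.natEmbedding K p, fun p q hpq => ?_⟩
    rw [sub_ne_zero]
    exact fun h => hpq (Fin.ext ((Infinite.natEmbedding K).injective h))
  let A' : Matrix (Fin n) (Fin n) (Polynomial K) := A.map Polynomial.C
  let Δ : Matrix (Fin n) (Fin n) (Polynomial K) := Matrix.diagonal fun p => Polynomial.C (μ p)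
  have hA' : ∀ p, A' p p = 0 := fun p => by simp [A', hA]
  -- `M₁` lives on the fiber of `tA` through `Δ`, and `M₂` on the fiber of `A` through `tΔ`. Working
  -- over `K[t]` makes both traces polynomials in `t`.
  obtain ⟨M₁, hM₁⟩ := exists_isMulMatrix ((Polynomial.X : Polynomial K) • A') ((Polynomial.X : Polynomial K) • A' - Δ)
    (fun p => by rw [Matrix.smul_apply, hA', smul_zero]) (X i * X j - X k * X l)
  obtain ⟨M₂, hM₂⟩ := exists_isMulMatrix A' (A' - (Polynomial.X : Polynomial K) • Δ) hA'
    (X i * X j - X k * X l)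
  have hg : (X i * X j - X k * X l : MvPolynomial (Fin n) K).IsHomogeneous 2 :=
    ((isHomogeneous_X K i).mul (isHomogeneous_X K j)).sub
      ((isHomogeneous_X K k).mul (isHomogeneous_X K l))
  have hev₁ : ∀ t : K, IsMulMatrix (t • A) (t • A - Matrix.diagonal μ) (X i * X j - X k * X l)
      (M₁.map (Polynomial.evalRingHom t)) := by
    intro t
    have h := hM₁.map (Polynomial.evalRingHom t)
    have e1 : ((Polynomial.X : Polynomial K) • A').map (Polynomial.evalRingHom t) = t • A := by
      ext p q; simp [A', mul_comm t]
    have e2 : ((Polynomial.X : Polynomial K) • A' - Δ).map (Polynomial.evalRingHom t) =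
        t • A - Matrix.diagonal μ := by
      ext p q
      by_cases hpq : p = q
      · subst hpq; simp [A', Δ, mul_comm t]
      · simp [A', Δ, hpq, mul_comm t]
    rw [e1, e2] at h
    simpa only [map_sub, map_mul, map_X] using h
  have hev₂ : ∀ t : K, IsMulMatrix A (A - t • Matrix.diagonal μ) (X i * X j - X k * X l)
      (M₂.map (Polynomial.evalRingHom t)) := by
    intro t
    have h := hM₂.map (Polynomial.evalRingHom t)
    have e1 : A'.map (Polynomial.evalRingHom t) = A := by
      ext p q; simp [A']
    have e2 : (A' - (Polynomial.X : Polynomial K) • Δ).map (Polynomial.evalRingHom t) =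
        A - t • Matrix.diagonal μ := by
      ext p q
      by_cases hpq : p = q
      · subst hpq; simp [A', Δ, mul_comm t]
      · simp [A', Δ, hpq]
    rw [e1, e2] at h
    simpa only [map_sub, map_mul, map_X] using h
  have htr : ∀ (M : Matrix (ArtinIndex n) (ArtinIndex n) (Polynomial K)) (t : K),
      (M.map (Polynomial.evalRingHom t)).trace = M.trace.eval t := by
    intro M t
    exact (AddMonoidHom.map_trace (Polynomial.evalRingHom t : Polynomial K →+ K) M).symm
  -- Dilation by `t` carries the `M₂` fiber at `t⁻¹` to the `M₁` fiber at `t`; the exponent 2 is the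
  -- degree of `x_i x_j - x_k x_l`.
  have hscale : ∀ t ≠ 0, M₁.trace.eval t = t ^ 2 * M₂.trace.eval t⁻¹ := by
    intro t ht
    have h := (hev₂ t⁻¹).smul (mul_inv_cancel₀ ht) hg
    rw [smul_sub, smul_smul, mul_inv_cancel₀ ht, one_smul] at h
    rw [← htr, ← htr, (hev₁ t).unique (by simp [hA]) h, trace_scaled (mul_inv_cancel₀ ht)]
  have hzero : M₂.trace.coeff 0 = 0 := by
    rw [Polynomial.coeff_zero_eq_eval_zero, ← htr]
    have h := hev₂ 0
    rw [zero_smul, sub_zero] at h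
    obtain ⟨m, hm⟩ := exists_pow_mem_fiberIdeal A huniq
      (g := X i * X j - X k * X l) (by simp)
    exact h.trace_eq_zero_of_pow_mem hA hm
  -- Truncation modulo `t³` retains the `t²` coefficient and makes the perturbation expansion exact.
  let I : Ideal (Polynomial K) := Ideal.span {Polynomial.X ^ 3}
  let π : Polynomial K →+* Polynomial K ⧸ I := Ideal.Quotient.mk I
  have : Nontrivial (Polynomial K ⧸ I) := by
    refine Ideal.Quotient.nontrivial_iff.2 fun h => ?_
    have := Ideal.span_singleton_eq_top.1 h
    exact Polynomial.not_isUnit_X (isUnit_of_dvd_unit (Dvd.intro_left _ (pow_succ _ 2).symm) this)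
  have hM₃ := hM₁.map π
  have e1 : ((Polynomial.X : Polynomial K) • A').map π = π Polynomial.X • A'.map π := by
    ext p q; simp
  have e2 : ((Polynomial.X : Polynomial K) • A' - Δ).map π =
      π Polynomial.X • A'.map π - Matrix.diagonal fun p => π (Polynomial.C (μ p)) := by
    ext p q
    by_cases hpq : p = q
    · subst hpq; simp [Δ]
    · simp [Δ, hpq]
  rw [e1, e2] at hM₃
  simp only [map_sub, map_mul, map_X] at hM₃
  have hmod := trace_eq_of_isMulMatrix_of_cube_eq_zero (A'.map π)
    (Matrix.of fun p q => π (Polynomial.C (μ p - μ q)⁻¹)) (by simp [hA'])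
    (fun p q => by simp only [Matrix.map_apply, A', hsymm p q])
    (by rw [← map_pow]; exact Ideal.Quotient.eq_zero_iff_mem.2 (Ideal.mem_span_singleton_self _))
    (fun p => π (Polynomial.C (μ p)))
    (fun p q hpq => by
      rw [Matrix.of_apply, ← map_sub, ← map_mul, ← Polynomial.C_sub, ← Polynomial.C_mul,
        inv_mul_cancel₀ (hμ p q hpq), map_one, map_one])
    hij hkl hM₃
  have htrπ : (M₁.map π).trace = π M₁.trace :=
    (AddMonoidHom.map_trace π.toAddMonoidHom M₁).symm
  have hcoeff : M₁.trace.coeff 2 = n.factorial * (A i j ^ 2 - A k l ^ 2) := by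
    have h : π M₁.trace = π (Polynomial.X ^ 2 *
        Polynomial.C (n.factorial * (A i j ^ 2 - A k l ^ 2))) := by
      rw [← htrπ, hmod]
      simp [A']
    have hdvd := Ideal.mem_span_singleton.1 (Ideal.Quotient.eq.1 h)
    have := Polynomial.X_pow_dvd_iff.1 hdvd 2 (by norm_num)
    rw [Polynomial.coeff_sub, sub_eq_zero] at this
    rw [this, mul_comm, Polynomial.coeff_C_mul, Polynomial.coeff_X_pow, if_pos rfl, mul_one]
  rw [coeff_eq_of_eval_eq_pow_mul_eval_inv _ _ 2 hscale, hzero] at hcoeff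
  exact sub_eq_zero.1 ((mul_eq_zero.1 hcoeff.symm).resolve_left hn)

end Core

/-! ### Application to weighted graphs -/

theorem factorial_cast_ne_zero_of_ringChar {K : Type*} [Field K] {n : ℕ}
    (h : ringChar K = 0 ∨ n < ringChar K) : (n.factorial : K) ≠ 0 := by
  rw [Ne, ringChar.spec]
  rcases CharP.char_is_prime_or_zero K (ringChar K) with hp | h0
  · rw [hp.dvd_factorial]
    have := hp.pos
    omega
  · rw [h0, zero_dvd_iff]
    exact n.factorial_ne_zero

theorem corollaryB {K : Type*} [Field K] [IsAlgClosed K]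
    {V : Type*} [Fintype V] [DecidableEq V]
    (hchar : ringChar K = 0 ∨ Fintype.card V < ringChar K)
    (G : SimpleGraph V) [DecidableRel G.Adj]
    (w : Sym2 V → K) (hw : ∀ e ∈ G.edgeSet, w e ≠ 0)
    (hedgeless : G ≠ ⊥)
    (hcomplete : ¬ (G = ⊤ ∧ ∀ e ∈ G.edgeSet, ∀ f ∈ G.edgeSet, w e = w f ∨ w e = -w f)) :
    ∃ D : Matrix V V K, D.IsDiag ∧ D ≠ 0 ∧
      spectrumMultiset (weightedAdjMatrix G w + D) =
        spectrumMultiset (weightedAdjMatrix G w) := by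
  by_contra hno
  let e := Fintype.equivFin V
  let A := weightedAdjMatrix G w
  have huniq : ∀ x, (Matrix.reindex e e A - Matrix.diagonal x).charpoly =
      (Matrix.reindex e e A).charpoly → x = 0 := by
    intro x hx
    by_contra hx0
    refine hno ⟨-Matrix.diagonal (x ∘ e), (Matrix.isDiag_diagonal _).neg, ?_, ?_⟩
    · rw [neg_ne_zero]
      intro h
      refine hx0 (funext fun i => ?_)
      have := congrFun (congrFun h (e.symm i)) (e.symm i)
      simpa using this
    · have h : Matrix.reindex e e A - Matrix.diagonal x =
          Matrix.reindex e e (A + -Matrix.diagonal (x ∘ e)) := by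
        ext i j
        by_cases hij : i = j
        · subst hij; simp [sub_eq_add_neg]
        · simp [hij]
      rw [h, Matrix.charpoly_reindex, Matrix.charpoly_reindex] at hx
      rw [spectrumMultiset, spectrumMultiset, hx]
  have hsq : ∀ {a b c d : V}, a ≠ b → c ≠ d → A a b ^ 2 = A c d ^ 2 := by
    intro a b c d hab hcd
    have := sq_eq_sq_of_unique_fiber (factorial_cast_ne_zero_of_ringChar hchar)
      (Matrix.reindex e e A) (fun i => by simp [A, weightedAdjMatrix])
      (fun i j => by simp [A, weightedAdjMatrix, G.adj_comm, Sym2.eq_swap]) huniq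
      (e.injective.ne hab) (e.injective.ne hcd)
    simpa using this
  have hadj : ∀ {a b : V}, G.Adj a b → A a b = w s(a, b) := by
    intro a b h
    simp [A, weightedAdjMatrix, h]
  obtain ⟨a, b, hab⟩ := SimpleGraph.ne_bot_iff_exists_adj.1 hedgeless
  refine hcomplete ⟨?_, ?_⟩
  · ext c d
    rw [SimpleGraph.top_adj]
    -- A missing edge would give a zero entry, whose square would equal that of the nonzero weight
    -- of `ab`.
    refine ⟨fun h => h.ne, fun hcd => ?_⟩
    by_contra hn
    have h1 := hsq hab.ne hcd
    have h2 : A c d = 0 := by simp [A, weightedAdjMatrix, hn]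
    rw [hadj hab, h2] at h1
    exact hw s(a, b) hab (by simpa using h1)
  · intro p hp q hq
    induction p using Sym2.ind with | _ a b =>
    induction q using Sym2.ind with | _ c d =>
    have h1 : G.Adj a b := hp
    have h2 : G.Adj c d := hq
    have h := hsq h1.ne h2.ne
    rw [hadj h1, hadj h2] at h
    exact sq_eq_sq_iff_eq_or_eq_neg.1 h
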